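/- Let $d\ge 2$, $N\ge 1$, $\varepsilon>0$. For $1\le s\le N$ write $Z_s=(X_s,V_s)=(x_1,\dots,x_s,v_1,\dots,v_s)\in\mathbb R^{ds}\times\mathbb R^{ds}$ and $$\mathcal D_s=\{Z_s : |x_i-x_j|>\varepsilon \text{ for all } 1\le i<j\le s\}.$$ Let $\Sigma_s(i,j)$ be the set of $X_s$ with $|x_i-x_j|=\varepsilon$ and $|x_k-x_l|>\varepsilon$ for every other pair $\{k,l\}$. A point $Z_s$ with $X_s\in\Sigma_s(i,j)$ is post-collisional if $(x_j-x_i)\cdot(v_j-v_i)>0$. With $\omega=(x_j-x_i)/\varepsilon$, let $Z_s^*$ be obtained from $Z_s$ by replacing $v_i,v_j$ by $v_i^*=v_i+\omega\,\omega\cdot(v_j-v_i)$ and $v_j^*=v_j-\omega\,\omega\cdot(v_j-v_i)$, and let $Z_s^{(i)}$ be $Z_s$ with particle $i$ removed. For $1\le j\le N$ let $\hat\phi_{N,j}^{(s)}(t,Z_s)$, $1\le s\le N$, $t\ge 0$, be a solution of the hierarchy $$(\partial_t-V_s\cdot\nabla_{X_s})\hat\phi_{N,j}^{(s)}=0\quad\text{in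 }\mathcal D_s,\qquad 1\le s\le N,$$ $$\frac{\hat\phi_{N,j}^{(s)}(t,Z_s^*)}{N-s+1}-\hat\phi_{N,j}^{(s-1)}(t,(Z_s^*)^{(i)})-\hat\phi_{N,j}^{(s-1)}(t,(Z_s^*)^{(j)})=\frac{\hat\phi_{N,j}^{(s)}(t,Z_s)}{N-s+1}+\hat\phi_{N,j}^{(s-1)}(t,Z_s^{(i)})+\hat\phi_{N,j}^{(s-1)}(t,Z_s^{(j)})$$ for $2\le s\le N$, $t>0$, and all post-collisional $Z_s$ with $X_s\in\Sigma_s(i,j)$, with initial data $\hat\phi_{N,j}^{(s)}(0)=\mathbf 1_{\mathcal D_s}$ if $s=j$ and $\hat\phi_{N,j}^{(s)}(0)=0$ otherwise. The equations are understood along characteristics: $\hat\phi_{N,j}^{(s)}$ is constant along free trajectories $h\mapsto(t-h,X_s+hV_s,V_s)$ inside $\mathcal D_s$, and its values at boundary points where exactly one pair touches, with nonzero normal relative velocity, are the traces along these trajectories. Then for every $t>0$: 1. if $1\le s<j$, then $\hat\phi_{N,j}^{(s)}(t,Z_s)=0$ for almost every $Z_s\in\mathcal D_s$; 2. $\hat\phi_{N,j}^{(j)}(t,Z_j)=\mathbf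 1_{\mathcal D_j}(Z_j)$ for almost every $Z_j\in\mathcal D_j$; 3. if $j<s\le N$, then for almost every $Z_s\in\mathcal D_s$ the value $\hat\phi_{N,j}^{(s)}(t,Z_s)$ is a nonnegative integer multiple of $(N-j)(N-j-1)\cdots(N-s+1)$. -/

import Mathlib

namespace HardSphere

/-- Configurations `Z_s = (X_s, V_s)` of `s` particles in `ℝ^d`
(positions, velocities), with Lebesgue measure as `volume`. -/
abbrev Config (d s : ℕ) : Type :=
  (Fin s → EuclideanSpace ℝ (Fin d)) × (Fin s → EuclideanSpace ℝ (Fin d))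

/-- The phase space `𝒟_s` of `s` hard spheres of diameter `ε`. -/
def phaseSpace (d : ℕ) (ε : ℝ) (s : ℕ) : Set (Config d s) :=
  {Z | ∀ i j : Fin s, i < j → ε < ‖Z.1 i - Z.1 j‖}

/-- `Σ_s(i,j) × ℝ^{ds}`: the spheres `i`, `j` touch, and no other pair does (or overlaps). -/
def contact (d : ℕ) (ε : ℝ) (s : ℕ) (i j : Fin s) : Set (Config d s) :=
  {Z | ‖Z.1 i - Z.1 j‖ = ε ∧
    ∀ k l : Fin s, k ≠ l → ¬(k = i ∧ l = j) → ¬(k = j ∧ l = i) → ε < ‖Z.1 k - Z.1 l‖}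

/-- Post-collisional (outgoing) points of `Σ_s(i,j) × ℝ^{ds}`. -/
def postContact (d : ℕ) (ε : ℝ) (s : ℕ) (i j : Fin s) : Set (Config d s) :=
  {Z | Z ∈ contact d ε s i j ∧ 0 < inner ℝ (Z.1 j - Z.1 i) (Z.2 j - Z.2 i)}

/-- `𝒟_s` together with the boundary points at which exactly one pair of spheres touches, with
non-zero normal relative velocity. -/
def regularPoints (d : ℕ) (ε : ℝ) (s : ℕ) : Set (Config d s) :=
  phaseSpace d ε s ∪
    {Z | ∃ i j : Fin s, i ≠ j ∧ Z ∈ contact d ε s i j ∧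
      inner ℝ (Z.1 j - Z.1 i) (Z.2 j - Z.2 i) ≠ 0}

/-- The collisional change of variables `Z_s ↦ Z_s^*` for the pair `i`, `j`, where
`x_j = x_i + ε ω`. -/
noncomputable def collide {d s : ℕ} (ε : ℝ) (i j : Fin s) (Z : Config d s) : Config d s :=
  let ω : EuclideanSpace ℝ (Fin d) := ε⁻¹ • (Z.1 j - Z.1 i)
  let c : ℝ := inner ℝ ω (Z.2 j - Z.2 i)
  (Z.1, Function.update (Function.update Z.2 i (Z.2 i + c • ω)) j (Z.2 j - c • ω))

/-- Free transport for a time `τ`. -/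
def freeFlow {d s : ℕ} (τ : ℝ) (Z : Config d s) : Config d s :=
  (fun i => Z.1 i + τ • Z.2 i, Z.2)

/-- `Z_s^{(i)}`: the configuration with particle `i` removed. -/
def erase {d n : ℕ} (i : Fin (n + 1)) (Z : Config d (n + 1)) : Config d n :=
  (fun k => Z.1 (i.succAbove k), fun k => Z.2 (i.succAbove k))

/-- `φ s t Z` (for `1 ≤ s ≤ N`, `t ≥ 0`) solves the hierarchy
`(∂_t - V_s · ∇_{X_s}) φ^{(s)} = 0` in `𝒟_s`, with jump condition
`φ^{(s)}(t,Z^*)/(N-s+1) - φ^{(s-1)}(t,(Z^*)^{(i)}) - φ^{(s-1)}(t,(Z^*)^{(j)})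
  = φ^{(s)}(t,Z)/(N-s+1) + φ^{(s-1)}(t,Z^{(i)}) + φ^{(s-1)}(t,Z^{(j)})`
at post-collisional boundary points, in the sense of characteristics. -/
structure IsSolution (d N : ℕ) (ε : ℝ) (φ : (s : ℕ) → ℝ → Config d s → ℝ) : Prop where
  /-- `φ^{(s)}` is constant along every characteristic `t + h - τ ↦ (X + τ V, V)` that runs inside
  `𝒟_s` for `0 < τ < h`. The end points of the segment may lie on the regular part of the boundary:
  this says that the value of `φ^{(s)}` there is its trace along the characteristic. -/
  transport : ∀ s : ℕ, 1 ≤ s → s ≤ N → ∀ (Z : Config d s) (t h : ℝ), 0 ≤ t → 0 < h →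
    Z ∈ regularPoints d ε s → freeFlow h Z ∈ regularPoints d ε s →
    (∀ τ ∈ Set.Ioo 0 h, freeFlow τ Z ∈ phaseSpace d ε s) →
    φ s (t + h) Z = φ s t (freeFlow h Z)
  /-- The jump condition, for `s = n + 1`. -/
  jump : ∀ n : ℕ, 1 ≤ n → n + 1 ≤ N → ∀ (i j : Fin (n + 1)), i ≠ j →
    ∀ t : ℝ, 0 < t → ∀ Z ∈ postContact d ε (n + 1) i j,
    φ (n + 1) t (collide ε i j Z) / ((N : ℝ) - ((n + 1 : ℕ) : ℝ) + 1)
        - φ n t (erase i (collide ε i j Z)) - φ n t (erase j (collide ε i j Z))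
      = φ (n + 1) t Z / ((N : ℝ) - ((n + 1 : ℕ) : ℝ) + 1)
        + φ n t (erase i Z) + φ n t (erase j Z)

open Classical in
/-- The initial data: `𝟙_{𝒟_s}` if `s = j`, and `0` otherwise. -/
noncomputable def initialData (d : ℕ) (ε : ℝ) (j s : ℕ) (Z : Config d s) : ℝ :=
  if s = j then (phaseSpace d ε s).indicator 1 Z else 0

/-- `φ` is `φ̂_{N,j}`: the solution of the hierarchy with the above initial data. -/
structure IsPhiHat (d N : ℕ) (ε : ℝ) (j : ℕ) (φ : (s : ℕ) → ℝ → Config d s → ℝ) : Prop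
    extends IsSolution d N ε φ where
  initial : ∀ s : ℕ, 1 ≤ s → s ≤ N → ∀ Z ∈ phaseSpace d ε s,
    φ s 0 Z = initialData d ε j s Z

end HardSphere

/-! Call a point of the phase space bad at time `t` if the value there is not of the predicted form,
`Admissible`. Bad sets are shown to be null by induction on the number of particles. Along a
trajectory of `n + 1` particles with a single collision, transport and the jump condition combine
into `IsSolution.through_collision`: the later value at the starting point is the earlier value at
the end point plus `N - n` times the sum of four values of the `n`-particle function. All
coefficients are positive and `N - n` is the next factor of the product, so admissibility propagates
(`Admissible.collision`).

To avoid constructing the hard-sphere flow for all times, `[0, t]` is cut into `m` steps of length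
`δ = t / m`. At bounded energy and positions, and up to a null set of grazing trajectories, a step
is either free flight or one binary collision, unless two different pairs start within `O(δ)` of
contact. Such configurations have volume `O(δ²)` (`exists_volume_twoClosePairs_le`). Everywhere else
the step map, followed by velocity reversal, is an involution with Jacobian `±1`, so pulling the bad
set back does not increase its volume (`measure_stepMap_preimage_le`). The volume of the bad set
thus grows by at most `O(δ²)` per step, in total `O(1/m)`, which tends to `0`
(`IsSolution.volume_badSet_succ`). -/

namespace HardSphere

open Filter Topology MeasureTheory

/-! ### Two-body kinematics: the quadratic equation for the contact time. -/

section TwoBody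

variable {E : Type*} [NormedAddCommGroup E] [InnerProductSpace ℝ E]

/-- Discriminant of the equation `‖x + τ v‖ = ε` in `τ`, divided by four. -/
noncomputable def disc (ε : ℝ) (x v : E) : ℝ := inner ℝ x v ^ 2 - ‖v‖ ^ 2 * (‖x‖ ^ 2 - ε ^ 2)

/-- The smaller root of `‖x + τ v‖ = ε`. -/
noncomputable def hitTime (ε : ℝ) (x v : E) : ℝ := (-inner ℝ x v - √(disc ε x v)) / ‖v‖ ^ 2

/-- A particle at relative position `x` and velocity `v` hits the sphere of radius `ε`
transversally, at some time in `(0, δ)`. -/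
def WillHit (ε δ : ℝ) (x v : E) : Prop :=
  ε < ‖x‖ ∧ inner ℝ x v < 0 ∧ 0 < disc ε x v ∧ hitTime ε x v < δ

lemma norm_add_smul_sq (x v : E) (τ : ℝ) :
    ‖x + τ • v‖ ^ 2 = ‖x‖ ^ 2 + 2 * τ * inner ℝ x v + τ ^ 2 * ‖v‖ ^ 2 := by
  rw [norm_add_sq_real, inner_smul_right, norm_smul, mul_pow, Real.norm_eq_abs, sq_abs]; ring

lemma inner_add_smul (x v : E) (τ : ℝ) :
    inner ℝ (x + τ • v) v = inner ℝ x v + τ * ‖v‖ ^ 2 := by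
  rw [inner_add_left, real_inner_smul_left, real_inner_self_eq_norm_sq]

lemma disc_add_smul (ε : ℝ) (x v : E) (τ : ℝ) : disc ε (x + τ • v) v = disc ε x v := by
  simp only [disc, norm_add_smul_sq, inner_add_smul]; ring

lemma disc_neg (ε : ℝ) (x v : E) : disc ε x (-v) = disc ε x v := by simp [disc]

namespace WillHit

variable {ε δ : ℝ} {x v : E}

lemma norm_sq_pos (h : WillHit ε δ x v) : 0 < ‖v‖ ^ 2 := by
  have : v ≠ 0 := by
    rintro rfl
    simpa using h.2.1
  positivity

lemma norm_sq_mul_hitTime (h : WillHit ε δ x v) :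
    ‖v‖ ^ 2 * hitTime ε x v = -inner ℝ x v - √(disc ε x v) := by
  have := h.norm_sq_pos
  rw [hitTime, mul_comm, div_mul_cancel₀ _ this.ne']

lemma hitTime_pos (hε : 0 < ε) (h : WillHit ε δ x v) : 0 < hitTime ε x v := by
  have hv := h.norm_sq_pos
  obtain ⟨h1, h2, h3, -⟩ := h
  refine div_pos ?_ hv
  have : √(disc ε x v) < -inner ℝ x v := by
    rw [Real.sqrt_lt' (by linarith), disc]
    have : 0 < ‖v‖ ^ 2 * (‖x‖ ^ 2 - ε ^ 2) := mul_pos hv (by nlinarith)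
    nlinarith
  linarith

lemma inner_hit (h : WillHit ε δ x v) :
    inner ℝ (x + hitTime ε x v • v) v = -√(disc ε x v) := by
  rw [inner_add_smul, mul_comm, h.norm_sq_mul_hitTime]; ring

lemma norm_hit (hε : 0 < ε) (h : WillHit ε δ x v) : ‖x + hitTime ε x v • v‖ = ε := by
  have hv := h.norm_sq_pos
  have h1 := h.inner_hit
  have h2 := disc_add_smul ε x v (hitTime ε x v)
  have h3 := Real.sq_sqrt h.2.2.1.le
  rw [disc, h1, neg_sq, h3] at h2
  have h4 : ‖v‖ ^ 2 * (‖x + hitTime ε x v • v‖ ^ 2 - ε ^ 2) = 0 := by linarith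
  have h5 := (mul_eq_zero.1 h4).resolve_left hv.ne'
  exact (sq_eq_sq₀ (norm_nonneg _) hε.le).1 (by linarith)

lemma lt_norm_before (hε : 0 < ε) (h : WillHit ε δ x v) {σ : ℝ} (hσ : σ < hitTime ε x v) :
    ε < ‖x + σ • v‖ := by
  have hv := h.norm_sq_pos
  have e : x + σ • v = (x + hitTime ε x v • v) + (σ - hitTime ε x v) • v := by
    rw [sub_smul]; abel
  have := norm_add_smul_sq (x + hitTime ε x v • v) v (σ - hitTime ε x v)
  rw [← e, h.inner_hit, h.norm_hit hε] at this
  have hs := Real.sqrt_nonneg (disc ε x v)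
  refine lt_of_pow_lt_pow_left₀ 2 (norm_nonneg _) ?_
  rw [this]
  have : 0 < (hitTime ε x v - σ) ^ 2 * ‖v‖ ^ 2 := mul_pos (pow_pos (by linarith) 2) hv
  nlinarith [mul_nonneg (sub_nonneg.2 hσ.le) hs]

end WillHit

lemma lt_norm_after {ε : ℝ} {y w : E} (hy : ‖y‖ = ε) (h : 0 < inner ℝ y w) {σ : ℝ}
    (hσ : 0 < σ) : ε < ‖y + σ • w‖ := by
  refine lt_of_pow_lt_pow_left₀ 2 (norm_nonneg _) ?_
  rw [norm_add_smul_sq, hy]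
  have := mul_pos hσ h
  nlinarith [mul_nonneg (sq_nonneg σ) (sq_nonneg ‖w‖)]

/-- If the squared distance, a quadratic in time that starts above `ε ^ 2`, were at most `ε ^ 2` at
`σ`, the particles would be approaching and the discriminant would be nonnegative, hence positive by
`hd`. A hit no earlier than `δ` then either comes after `σ`, which is impossible, or happens exactly
at `δ`, which `hδ` excludes. -/
lemma lt_norm_of_not_willHit {ε δ : ℝ} (hε : 0 < ε) {x v : E} (hx : ε < ‖x‖)
    (h : ¬ WillHit ε δ x v) (hd : disc ε x v ≠ 0) (hδ : ‖x + δ • v‖ ≠ ε) {σ : ℝ} (h0 : 0 ≤ σ)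
    (hσ : σ ≤ δ) : ε < ‖x + σ • v‖ := by
  by_contra! hc
  have hv0 : v ≠ 0 := by
    rintro rfl
    simp at hc; linarith
  have hv : 0 < ‖v‖ ^ 2 := by positivity
  have hs : ‖x + σ • v‖ ^ 2 ≤ ε ^ 2 := by gcongr
  have hx2 : ε ^ 2 < ‖x‖ ^ 2 := by gcongr
  have h1 : inner ℝ x v < 0 := by
    rw [norm_add_smul_sq] at hs
    by_contra! h1
    nlinarith [mul_nonneg h0 h1, mul_nonneg (sq_nonneg σ) hv.le]
  have h2 : 0 < disc ε x v := by
    refine lt_of_le_of_ne ?_ hd.symm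
    rw [← disc_add_smul ε x v σ, disc]
    nlinarith [sq_nonneg (inner ℝ (x + σ • v) v), mul_nonneg hv.le (sub_nonneg.2 hs)]
  have h3 : ¬ hitTime ε x v < δ := fun h3 => h ⟨hx, h1, h2, h3⟩
  have hw : WillHit ε (hitTime ε x v + 1) x v := ⟨hx, h1, h2, by linarith⟩
  rcases (not_lt.1 h3).lt_or_eq with h4 | h4
  · exact absurd (hw.lt_norm_before hε (hσ.trans_lt h4)) (not_lt.2 hc)
  · exact hδ (h4 ▸ hw.norm_hit hε)

/-- Time reversal: the reflected trajectory, run backwards, hits after the remaining time. -/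
lemma willHit_reverse {ε δ τ : ℝ} {y w : E} (hy : ‖y‖ = ε) (h : 0 < inner ℝ y w)
    (hτ : 0 < τ) (hτδ : τ < δ) :
    WillHit ε δ (y + τ • w) (-w) ∧ hitTime ε (y + τ • w) (-w) = τ := by
  have hw0 : w ≠ 0 := by
    rintro rfl
    simp at h
  have hw : 0 < ‖w‖ ^ 2 := by positivity
  have hd : disc ε (y + τ • w) (-w) = inner ℝ y w ^ 2 := by
    rw [disc_neg, disc_add_smul, disc, hy]; ring
  have ht : hitTime ε (y + τ • w) (-w) = τ := by
    rw [hitTime, hd, Real.sqrt_sq h.le, inner_neg_right, inner_add_smul, norm_neg]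
    field_simp
    ring
  refine ⟨⟨lt_norm_after hy h hτ, ?_, by rw [hd]; positivity, by rwa [ht]⟩, ht⟩
  rw [inner_neg_right, inner_add_smul]
  have := mul_pos hτ hw
  linarith

end TwoBody

/-! ### The reversed collision map is an antisymplectic involution. -/

section Jacobian

/-- Taking determinants in `Lᵀ J L = -J` gives `det L ^ 2 = ±1`; the absolute value makes the parity
of the dimension irrelevant. -/
lemma abs_det_eq_one_of_antisymplectic {F : Type*} [AddCommGroup F] [Module ℝ F]
    [FiniteDimensional ℝ F] {B : LinearMap.BilinForm ℝ F} (hB : B.Nondegenerate) {L : F →ₗ[ℝ] F}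
    (h : ∀ p q, B (L p) (L q) = -B p q) : |LinearMap.det L| = 1 := by
  let b := Module.finBasis ℝ F
  have hd : (LinearMap.BilinForm.toMatrix b B).det ≠ 0 :=
    (LinearMap.BilinForm.nondegenerate_iff_det_ne_zero b).1 hB
  have h1 : B.comp L L = -B := by
    ext p q
    simp [h]
  have h2 := congrArg (fun C => (LinearMap.BilinForm.toMatrix b C).det) h1
  have hn : LinearMap.BilinForm.toMatrix b (-B) = -LinearMap.BilinForm.toMatrix b B := by
    ext p q
    simp [LinearMap.BilinForm.toMatrix_apply]
  simp only [LinearMap.BilinForm.toMatrix_comp b b, hn, Matrix.det_mul, Matrix.det_transpose,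
    Matrix.det_neg, LinearMap.det_toMatrix] at h2
  have h3 : LinearMap.det L ^ 2 = (-1) ^ Fintype.card (Fin (Module.finrank ℝ F)) := by
    apply mul_right_cancel₀ hd
    linear_combination h2
  have h4 : |LinearMap.det L| ^ 2 = 1 := by
    rw [← abs_pow, h3, abs_pow]; simp
  exact (pow_eq_one_iff_of_nonneg (abs_nonneg _) two_ne_zero).1 h4

variable {H E : Type*} [NormedAddCommGroup H] [NormedSpace ℝ H] [NormedAddCommGroup E]
  [InnerProductSpace ℝ E]

/-- Free transport up to time `τ`, reflection with respect to the sphere `‖r X‖ = ε`,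
free transport up to time `δ`, and reversal of the velocity. -/
noncomputable def reflectMap (r : H →L[ℝ] E) (a : E →L[ℝ] H) (ε δ : ℝ) (τ : H × H → ℝ)
    (Z : H × H) : H × H :=
  (Z.1 + δ • Z.2 + ((δ - τ Z) * ((ε⁻¹) ^ 2 * inner ℝ (r (Z.1 + τ Z • Z.2)) (r Z.2))) •
      a (r (Z.1 + τ Z • Z.2)),
    -(Z.2 + ((ε⁻¹) ^ 2 * inner ℝ (r (Z.1 + τ Z • Z.2)) (r Z.2)) • a (r (Z.1 + τ Z • Z.2))))

/-- `A` is the variation of the contact configuration `Z.1 + τ Z • Z.2` and `B` that of the outgoing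
velocity. Keeping them as variables lets the symplectic computation work with these two quantities
only. -/
lemma hasFDerivAt_reflectMap (r : H →L[ℝ] E) (a : E →L[ℝ] H) (ε δ : ℝ) {τ : H × H → ℝ}
    {τ' : H × H →L[ℝ] ℝ} {Z : H × H} (hτ : HasFDerivAt τ τ' Z) :
    ∃ L : H × H →L[ℝ] H × H, HasFDerivAt (reflectMap r a ε δ τ) L Z ∧ ∀ p : H × H,
      ∀ A B : H, A = p.1 + τ Z • p.2 + τ' p • Z.2 →
      B = p.2 + ((ε⁻¹) ^ 2 * inner ℝ (r (Z.1 + τ Z • Z.2)) (r Z.2)) • a (r A) +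
        ((ε⁻¹) ^ 2 * (inner ℝ (r (Z.1 + τ Z • Z.2)) (r p.2) + inner ℝ (r A) (r Z.2))) •
          a (r (Z.1 + τ Z • Z.2)) →
      L p = (A + (δ - τ Z) • B - τ' p • (Z.2 + ((ε⁻¹) ^ 2 *
        inner ℝ (r (Z.1 + τ Z • Z.2)) (r Z.2)) • a (r (Z.1 + τ Z • Z.2))), -B) := by
  have h1 : HasFDerivAt (fun Z : H × H => Z.1) (ContinuousLinearMap.fst ℝ H H) Z := hasFDerivAt_fst
  have h2 : HasFDerivAt (fun Z : H × H => Z.2) (ContinuousLinearMap.snd ℝ H H) Z := hasFDerivAt_snd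
  have hy := r.hasFDerivAt.comp Z (h1.add (hτ.smul h2))
  have hv := r.hasFDerivAt.comp Z h2
  have hk := (hy.inner ℝ hv).const_mul ((ε⁻¹) ^ 2)
  have hay := a.hasFDerivAt.comp Z hy
  have hX := (h1.add (h2.const_smul δ)).add (((hτ.const_sub δ).mul hk).smul hay)
  have hV := (h2.add (hk.smul hay)).neg
  refine ⟨_, hX.prodMk hV, ?_⟩
  rintro p A B rfl rfl
  ext1
  · simp [add_assoc]
    module
  · simp [add_assoc]

/-- Three facts make the form change sign only: contact variations are tangent to the sphere, the
reflection contributes a symmetric term that cancels on antisymmetrization, and the terms in `τ'`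
are controlled by conservation of energy. The sign itself comes from the velocity reversal. -/
lemma reflectMap_antisymplectic {β : LinearMap.BilinForm ℝ H} (hβ : ∀ X Y, β X Y = β Y X)
    {r : H →L[ℝ] E} {a : E →L[ℝ] H} (ha : ∀ y U, β (a y) U = -inner ℝ y (r U))
    (hra : ∀ y, r (a y) = (-2 : ℝ) • y) {ε δ : ℝ} (hε : 0 < ε) {τ : H × H → ℝ} {Z : H × H}
    (hτ : DifferentiableAt ℝ τ Z) (hhit : ∀ᶠ Z in 𝓝 Z, ‖r (Z.1 + τ Z • Z.2)‖ = ε) :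
    ∃ L : H × H →L[ℝ] H × H, HasFDerivAt (reflectMap r a ε δ τ) L Z ∧ ∀ p q : H × H,
      β (L p).1 (L q).2 - β (L q).1 (L p).2 = -(β p.1 q.2 - β q.1 p.2) := by
  obtain ⟨L, hL, hLp⟩ := hasFDerivAt_reflectMap r a ε δ hτ.hasFDerivAt
  refine ⟨L, hL, ?_⟩
  set τ' := fderiv ℝ τ Z
  set y := r (Z.1 + τ Z • Z.2) with hydef
  set κ := (ε⁻¹) ^ 2 * inner ℝ y (r Z.2) with hκ
  have hyy : inner ℝ y y = ε ^ 2 := by rw [real_inner_self_eq_norm_sq, hhit.self_of_nhds]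
  have hκ' : inner ℝ y (r Z.2) = κ * ε ^ 2 := by rw [hκ]; field_simp
  -- The contact identity holds near `Z`, so it may be differentiated: variations of the contact
  -- point are orthogonal to its normal.
  have horth : ∀ p : H × H, inner ℝ y (r (p.1 + τ Z • p.2 + τ' p • Z.2)) = 0 := by
    intro p
    have h1 : HasFDerivAt (fun Z : H × H => Z.1) (ContinuousLinearMap.fst ℝ H H) Z :=
      hasFDerivAt_fst
    have h2 : HasFDerivAt (fun Z : H × H => Z.2) (ContinuousLinearMap.snd ℝ H H) Z :=
      hasFDerivAt_snd
    have hy := (r.hasFDerivAt.comp Z (h1.add (hτ.hasFDerivAt.smul h2))).norm_sq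
    have hc : HasFDerivAt (fun Z : H × H => ‖r (Z.1 + τ Z • Z.2)‖ ^ 2) (0 : H × H →L[ℝ] ℝ) Z :=
      (hasFDerivAt_const (ε ^ 2) Z).congr_of_eventuallyEq (hhit.mono fun Z h => by simp only [h])
    have := congrArg (fun l : H × H →L[ℝ] ℝ => l p) (hy.unique hc)
    simp [← hydef] at this
    simp only [map_add, map_smul, inner_add_right, inner_smul_right]
    linarith
  have ha' : ∀ y U, β U (a y) = -inner ℝ y (r U) := fun y U => by rw [hβ, ha]
  have key : ∀ p : H × H, ∃ A B : H, ∃ k : ℝ, A = p.1 + τ Z • p.2 + τ' p • Z.2 ∧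
      B = p.2 + κ • a (r A) + k • a y ∧
      k * ε ^ 2 = inner ℝ y (r p.2) + inner ℝ (r A) (r Z.2) ∧ inner ℝ y (r A) = 0 ∧
      L p = (A + (δ - τ Z) • B - τ' p • (Z.2 + κ • a y), -B) := by
    intro p
    refine ⟨_, _, _, rfl, rfl, ?_, horth p, hLp p _ _ rfl rfl⟩
    field_simp
  intro p q
  obtain ⟨A, B, k, hA, hB, hk, hyA, hp⟩ := key p
  obtain ⟨A₂, B₂, k₂, hA₂, hB₂, hk₂, hyA₂, hq⟩ := key q
  -- The correction `κ * inner ℝ (r A) (r A')` is symmetric in the two variations.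
  have f1 : ∀ (A B A' : H) (k : ℝ) (b : H), B = b + κ • a (r A) + k • a y → inner ℝ y (r A') = 0 →
      β A' B = β A' b - κ * inner ℝ (r A) (r A') := by
    rintro A B A' k b rfl h
    simp only [map_add, map_smul, smul_eq_mul, ha', h]
    ring
  -- Linearized conservation of energy: outgoing velocity against its variation equals incoming
  -- velocity against its own.
  have f2 : ∀ (A B b : H) (k : ℝ), B = b + κ • a (r A) + k • a y → inner ℝ y (r A) = 0 →
      k * ε ^ 2 = inner ℝ y (r b) + inner ℝ (r A) (r Z.2) →
      β (Z.2 + κ • a y) B = β Z.2 b := by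
    rintro A B b k rfl h hk
    rw [real_inner_comm] at h
    simp only [map_add, map_smul, smul_eq_mul, ha', ha, hra, LinearMap.add_apply,
      LinearMap.smul_apply, inner_smul_right, h, hyy, hκ']
    linear_combination κ * hk
  rw [hp, hq]
  simp only [map_sub, map_add, map_smul, map_neg, LinearMap.sub_apply, LinearMap.add_apply,
    LinearMap.smul_apply, smul_eq_mul]
  have g1 := f1 A₂ B₂ A k₂ q.2 hB₂ hyA
  have g2 := f1 A B A₂ k p.2 hB hyA₂
  have g3 := f2 A B p.2 k hB hyA hk
  have g4 := f2 A₂ B₂ q.2 k₂ hB₂ hyA₂ hk₂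
  have g5 := hβ B B₂
  have g6 : β A q.2 = β p.1 q.2 + τ Z * β p.2 q.2 + τ' p * β Z.2 q.2 := by simp [hA]
  have g7 : β A₂ p.2 = β q.1 p.2 + τ Z * β q.2 p.2 + τ' q * β Z.2 p.2 := by simp [hA₂]
  have g8 := hβ p.2 q.2
  have g9 := real_inner_comm (r A) (r A₂)
  simp only [map_add, map_smul, LinearMap.add_apply, LinearMap.smul_apply, smul_eq_mul] at g3 g4
  linear_combination -g1 + g2 - τ' q * g3 + τ' p * g4 - (δ - τ Z) * g5 - g6 + g7 - τ Z * g8 + κ * g9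

/-- Run backwards, the outgoing trajectory reaches the same contact point after time `δ - τ`.
Reflection and reversal each change the sign of the normal velocity, so the impulse coefficient `κ`
is the same and the second collision undoes the first. -/
lemma reflectMap_reflectMap {r : H →L[ℝ] E} {a : E →L[ℝ] H} (hra : ∀ y, r (a y) = (-2 : ℝ) • y)
    {ε δ : ℝ} (hε : 0 < ε) {Z : H × H} (hZ : WillHit ε δ (r Z.1) (r Z.2)) :
    WillHit ε δ (r (reflectMap r a ε δ (fun Z => hitTime ε (r Z.1) (r Z.2)) Z).1)
        (r (reflectMap r a ε δ (fun Z => hitTime ε (r Z.1) (r Z.2)) Z).2) ∧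
      reflectMap r a ε δ (fun Z => hitTime ε (r Z.1) (r Z.2))
        (reflectMap r a ε δ (fun Z => hitTime ε (r Z.1) (r Z.2)) Z) = Z := by
  obtain ⟨X, V⟩ := Z
  dsimp only at hZ
  have h0 := hZ.hitTime_pos hε
  have h1 := hZ.2.2.2
  have hn := hZ.norm_hit hε
  have hin := hZ.inner_hit
  have hs := Real.sqrt_pos.2 hZ.2.2.1
  set τ := hitTime ε (r X) (r V) with hτ
  set y := r X + τ • r V with hy
  set κ := (ε⁻¹) ^ 2 * inner ℝ y (r V) with hκ
  have hyr : r (X + τ • V) = y := by simp [hy]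
  have hκ' : inner ℝ y (r V) = κ * ε ^ 2 := by rw [hκ]; field_simp
  have hyy : inner ℝ y y = ε ^ 2 := by rw [real_inner_self_eq_norm_sq, hn]
  have hW : reflectMap r a ε δ (fun Z => hitTime ε (r Z.1) (r Z.2)) (X, V) =
      (X + τ • V + (δ - τ) • (V + κ • a y), -(V + κ • a y)) := by
    simp only [reflectMap, ← hτ, hyr, ← hκ]
    ext1
    · dsimp only
      module
    · rfl
  set w := r V - (2 * κ) • y with hw
  have hrw : r (V + κ • a y) = w := by
    simp only [map_add, map_smul, hra, hw]
    module
  have hyw : inner ℝ y w = -(κ * ε ^ 2) := by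
    rw [hw, inner_sub_right, inner_smul_right, hκ', hyy]; ring
  have hpos : 0 < inner ℝ y w := by linarith
  obtain ⟨g1, g2⟩ := willHit_reverse hn hpos (sub_pos.2 h1) (show δ - τ < δ by linarith)
  have hr1 : r (X + τ • V + (δ - τ) • (V + κ • a y)) = y + (δ - τ) • w := by
    rw [map_add, hyr, map_smul, hrw]
  have hr2 : r (-(V + κ • a y)) = -w := by rw [map_neg, hrw]
  rw [hW]
  refine ⟨by rwa [hr1, hr2], ?_⟩
  have hpos : X + τ • V + (δ - τ) • (V + κ • a y) + (δ - τ) • -(V + κ • a y) = X + τ • V := by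
    module
  have hk : (ε⁻¹) ^ 2 * inner ℝ y (-w) = κ := by
    rw [inner_neg_right, hyw]; field_simp
  simp only [reflectMap, hr1, hr2, g2, hpos, hyr, hk]
  ext1
  · dsimp only
    module
  · dsimp only
    module

end Jacobian

/-! ### Collision and free transport as maps of the `s`-particle phase space. -/

section PhaseSpaceMaps

variable {d s : ℕ}

/-- The relative position (or velocity) `x_j - x_i`. -/
noncomputable def relCLM (d : ℕ) {s : ℕ} (i j : Fin s) :
    (Fin s → EuclideanSpace ℝ (Fin d)) →L[ℝ] EuclideanSpace ℝ (Fin d) :=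
  ContinuousLinearMap.proj (φ := fun _ : Fin s => EuclideanSpace ℝ (Fin d)) (R := ℝ) j -
    ContinuousLinearMap.proj i

/-- The transfer of the momentum `y` from particle `j` to particle `i`. -/
noncomputable def transferCLM (d : ℕ) {s : ℕ} (i j : Fin s) :
    EuclideanSpace ℝ (Fin d) →L[ℝ] (Fin s → EuclideanSpace ℝ (Fin d)) :=
  ContinuousLinearMap.single ℝ (fun _ : Fin s => EuclideanSpace ℝ (Fin d)) i -
    ContinuousLinearMap.single ℝ (fun _ : Fin s => EuclideanSpace ℝ (Fin d)) j

@[simp] lemma relCLM_apply (i j : Fin s) (X : Fin s → EuclideanSpace ℝ (Fin d)) :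
    relCLM d i j X = X j - X i := by simp [relCLM]

lemma transferCLM_apply (i j : Fin s) (y : EuclideanSpace ℝ (Fin d)) :
    transferCLM d i j y = Pi.single i y - Pi.single j y := by
  simp [transferCLM]

/-- The scalar product of `ℝ^{ds}`. -/
noncomputable def dotForm (d s : ℕ) :
    LinearMap.BilinForm ℝ (Fin s → EuclideanSpace ℝ (Fin d)) :=
  ∑ k, (innerₗ (EuclideanSpace ℝ (Fin d))).compl₁₂ (LinearMap.proj k) (LinearMap.proj k)

lemma dotForm_apply (X Y : Fin s → EuclideanSpace ℝ (Fin d)) :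
    dotForm d s X Y = ∑ k, inner ℝ (X k) (Y k) := by
  simp [dotForm, LinearMap.sum_apply]

lemma dotForm_comm (X Y : Fin s → EuclideanSpace ℝ (Fin d)) :
    dotForm d s X Y = dotForm d s Y X := by
  simp [dotForm_apply, real_inner_comm]

lemma dotForm_self_nonneg (X : Fin s → EuclideanSpace ℝ (Fin d)) : 0 ≤ dotForm d s X X := by
  rw [dotForm_apply]
  exact Finset.sum_nonneg fun k _ => real_inner_self_nonneg

lemma dotForm_self_eq_zero {X : Fin s → EuclideanSpace ℝ (Fin d)} (h : dotForm d s X X = 0) :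
    X = 0 := by
  rw [dotForm_apply, Finset.sum_eq_zero_iff_of_nonneg fun k _ => real_inner_self_nonneg] at h
  ext1 k
  exact inner_self_eq_zero.1 (h k (Finset.mem_univ k))

lemma dotForm_transfer (i j : Fin s) (y : EuclideanSpace ℝ (Fin d))
    (U : Fin s → EuclideanSpace ℝ (Fin d)) :
    dotForm d s (transferCLM d i j y) U = -inner ℝ y (relCLM d i j U) := by
  have h : ∀ i : Fin s, ∑ k, inner ℝ ((Pi.single i y : Fin s → EuclideanSpace ℝ (Fin d)) k) (U k) =
      inner ℝ y (U i) := by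
    intro i
    rw [Finset.sum_eq_single i]
    · simp
    · intro k _ hk
      simp [hk]
    · simp
  simp only [dotForm_apply, transferCLM_apply, Pi.sub_apply, inner_sub_left, Finset.sum_sub_distrib,
    h, relCLM_apply, inner_sub_right]
  ring

/-- The factor `-2`, one unit from each of two equal masses, is what makes the momentum transfer
reflect the relative velocity. -/
lemma rel_transfer {i j : Fin s} (hij : i ≠ j) (y : EuclideanSpace ℝ (Fin d)) :
    relCLM d i j (transferCLM d i j y) = (-2 : ℝ) • y := by
  simp [transferCLM_apply, hij, hij.symm]
  module

/-- The symplectic form of phase space. -/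
noncomputable def sympForm (d s : ℕ) : LinearMap.BilinForm ℝ (Config d s) :=
  (dotForm d s).compl₁₂ (LinearMap.fst ℝ _ _) (LinearMap.snd ℝ _ _) -
    ((dotForm d s).compl₁₂ (LinearMap.fst ℝ _ _) (LinearMap.snd ℝ _ _)).flip

lemma sympForm_apply (p q : Config d s) :
    sympForm d s p q = dotForm d s p.1 q.2 - dotForm d s q.1 p.2 := by
  simp [sympForm]

lemma sympForm_nondegenerate : (sympForm d s).Nondegenerate := by
  have h : ∀ p : Config d s, (∀ q, sympForm d s p q = 0) → p = 0 := by
    intro p hp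
    -- Pairing with this vector gives the sum of the squares of both components.
    have := hp (-p.2, p.1)
    simp only [sympForm_apply, map_neg, LinearMap.neg_apply, sub_neg_eq_add] at this
    have h1 := dotForm_self_nonneg p.1
    have h2 := dotForm_self_nonneg p.2
    exact Prod.ext (dotForm_self_eq_zero (by linarith)) (dotForm_self_eq_zero (by linarith))
  refine ⟨h, fun p hp => h p fun q => ?_⟩
  have := hp q
  rw [sympForm_apply] at this ⊢
  linarith

/-- Reversal of the velocities. -/
def reverse (Z : Config d s) : Config d s := (Z.1, -Z.2)

/-- Free transport up to the collision of the particles `i`, `j`, collision, and free transport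
up to time `δ`. -/
noncomputable def scatter (ε δ : ℝ) (i j : Fin s) (Z : Config d s) : Config d s :=
  freeFlow (δ - hitTime ε (Z.1 j - Z.1 i) (Z.2 j - Z.2 i))
    (collide ε i j (freeFlow (hitTime ε (Z.1 j - Z.1 i) (Z.2 j - Z.2 i)) Z))

lemma freeFlow_eq (τ : ℝ) (Z : Config d s) : freeFlow τ Z = (Z.1 + τ • Z.2, Z.2) := rfl

lemma collide_eq (ε : ℝ) {i j : Fin s} (hij : i ≠ j) (Z : Config d s) :
    collide ε i j Z = (Z.1, Z.2 + ((ε⁻¹) ^ 2 * inner ℝ (relCLM d i j Z.1) (relCLM d i j Z.2)) •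
      transferCLM d i j (relCLM d i j Z.1)) := by
  simp only [collide]
  ext1
  · rfl
  · ext1 k
    simp only [transferCLM_apply, relCLM_apply, real_inner_smul_left, Pi.add_apply, Pi.smul_apply,
      Pi.sub_apply]
    by_cases hj : k = j
    · subst hj
      simp [hij.symm, smul_smul]
      module
    · by_cases hi : k = i
      · subst hi
        simp [hij, smul_smul]
        module
      · simp [hi, hj]

/-- Scattering alone is not an involution; with velocity reversal it is, and it becomes an instance
of the abstract `reflectMap`. -/
lemma reverse_scatter (ε δ : ℝ) {i j : Fin s} (hij : i ≠ j) :
    (fun Z : Config d s => reverse (scatter ε δ i j Z)) = reflectMap (relCLM d i j) (transferCLM d i j)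
      ε δ (fun Z => hitTime ε (relCLM d i j Z.1) (relCLM d i j Z.2)) := by
  ext1 Z
  simp only [scatter, collide_eq ε hij, freeFlow_eq, reverse, reflectMap, ← relCLM_apply]
  ext1
  · dsimp only
    module
  · rfl

/-- The particles `i`, `j` collide before time `δ` if all other particles are ignored. -/
def hits (d : ℕ) {s : ℕ} (ε δ : ℝ) (i j : Fin s) : Set (Config d s) :=
  {Z | WillHit ε δ (Z.1 j - Z.1 i) (Z.2 j - Z.2 i)}

lemma measurableSet_hits (ε δ : ℝ) (i j : Fin s) : MeasurableSet (hits d ε δ i j) := by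
  have h1 : Measurable fun Z : Config d s => Z.1 j - Z.1 i := by fun_prop
  have h2 : Measurable fun Z : Config d s => Z.2 j - Z.2 i := by fun_prop
  have h3 : Measurable fun Z : Config d s => disc ε (Z.1 j - Z.1 i) (Z.2 j - Z.2 i) := by
    simp only [disc]; fun_prop
  have h4 : Measurable fun Z : Config d s => hitTime ε (Z.1 j - Z.1 i) (Z.2 j - Z.2 i) := by
    simp only [hitTime]
    exact ((h1.inner h2).neg.sub h3.sqrt).div (h2.norm.pow_const 2)
  have h5 : Measurable fun Z : Config d s => inner ℝ (Z.1 j - Z.1 i) (Z.2 j - Z.2 i) :=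
    h1.inner h2
  exact (measurableSet_lt measurable_const h1.norm).inter
    ((measurableSet_lt h5 measurable_const).inter
      ((measurableSet_lt measurable_const h3).inter (measurableSet_lt h4 measurable_const)))

lemma scatter_hasFDerivAt {ε δ : ℝ} (hε : 0 < ε) {i j : Fin s} (hij : i ≠ j) {Z : Config d s}
    (hZ : Z ∈ hits d ε δ i j) :
    ∃ L : Config d s →L[ℝ] Config d s,
      HasFDerivAt (fun Z => reverse (scatter ε δ i j Z)) L Z ∧ |L.det| = 1 := by
  rw [reverse_scatter ε δ hij]
  have hZ' : WillHit ε δ (relCLM d i j Z.1) (relCLM d i j Z.2) := by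
    simpa [hits] using hZ
  have hv : ‖relCLM d i j Z.2‖ ^ 2 ≠ 0 := hZ'.norm_sq_pos.ne'
  have hD : disc ε (relCLM d i j Z.1) (relCLM d i j Z.2) ≠ 0 := hZ'.2.2.1.ne'
  have h1 : Differentiable ℝ fun Z : Config d s => relCLM d i j Z.1 := by fun_prop
  have h2 : Differentiable ℝ fun Z : Config d s => relCLM d i j Z.2 := by fun_prop
  have h3 : Differentiable ℝ
      fun Z : Config d s => disc ε (relCLM d i j Z.1) (relCLM d i j Z.2) := by
    simp only [disc]
    exact ((h1.inner ℝ h2).pow 2).sub ((h2.norm_sq ℝ).mul ((h1.norm_sq ℝ).sub_const _))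
  have h4 : DifferentiableAt ℝ
      (fun Z : Config d s => hitTime ε (relCLM d i j Z.1) (relCLM d i j Z.2)) Z := by
    have h5 : DifferentiableAt ℝ (fun Z : Config d s => ‖relCLM d i j Z.2‖ ^ 2) Z :=
      (h2.norm_sq ℝ).differentiableAt
    simp only [hitTime]
    have h6 := (h1.inner ℝ h2).neg.differentiableAt.sub (h3.differentiableAt.sqrt hD)
    simp only [div_eq_mul_inv]
    exact h6.fun_mul (h5.fun_inv hv)
  -- The hitting conditions are open, so contact at the hitting time persists in a neighbourhood, as
  -- the differentiation of that identity requires.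
  have h5 : ∀ᶠ Z : Config d s in 𝓝 Z, WillHit ε δ (relCLM d i j Z.1) (relCLM d i j Z.2) := by
    filter_upwards [h1.continuous.norm.continuousAt.eventually (lt_mem_nhds hZ'.1),
      (h1.inner ℝ h2).continuous.continuousAt.eventually (gt_mem_nhds hZ'.2.1),
      h3.continuous.continuousAt.eventually (lt_mem_nhds hZ'.2.2.1),
      h4.continuousAt.eventually (gt_mem_nhds hZ'.2.2.2)] with Z g1 g2 g3 g4
    exact ⟨g1, g2, g3, g4⟩
  obtain ⟨L, hL, hs⟩ := reflectMap_antisymplectic dotForm_comm (dotForm_transfer i j)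
    (rel_transfer hij) (δ := δ) hε h4 (h5.mono fun Z h => by
      rw [map_add, map_smul]; exact h.norm_hit hε)
  refine ⟨L, hL, abs_det_eq_one_of_antisymplectic sympForm_nondegenerate fun p q => ?_⟩
  simp only [sympForm_apply]
  exact hs p q

lemma reverse_scatter_involutive {ε δ : ℝ} (hε : 0 < ε) {i j : Fin s} (hij : i ≠ j) {Z : Config d s}
    (hZ : Z ∈ hits d ε δ i j) :
    reverse (scatter ε δ i j Z) ∈ hits d ε δ i j ∧
      reverse (scatter ε δ i j (reverse (scatter ε δ i j Z))) = Z := by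
  have h := reflectMap_reflectMap (rel_transfer hij) (δ := δ) hε (Z := Z) (by simpa [hits] using hZ)
  rw [← reverse_scatter ε δ hij] at h
  exact ⟨by simpa [hits] using h.1, h.2⟩

lemma freeFlow_hasFDerivAt (δ : ℝ) (Z : Config d s) :
    ∃ L : Config d s →L[ℝ] Config d s,
      HasFDerivAt (fun Z => reverse (freeFlow δ Z)) L Z ∧ |L.det| = 1 := by
  let L : Config d s →L[ℝ] Config d s := ContinuousLinearMap.prod
    (ContinuousLinearMap.fst ℝ _ _ + δ • ContinuousLinearMap.snd ℝ _ _)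
    (-ContinuousLinearMap.snd ℝ _ _)
  have hL : (fun Z : Config d s => reverse (freeFlow δ Z)) = L := rfl
  rw [hL]
  refine ⟨L, L.hasFDerivAt, abs_det_eq_one_of_antisymplectic sympForm_nondegenerate fun p q => ?_⟩
  have := dotForm_comm p.2 q.2
  simp [sympForm_apply, L]
  linear_combination -δ * this

lemma reverse_reverse (Z : Config d s) : reverse (reverse Z) = Z := by simp [reverse]

lemma reverse_freeFlow_involutive (δ : ℝ) (Z : Config d s) :
    reverse (freeFlow δ (reverse (freeFlow δ Z))) = Z := by
  simp [reverse, freeFlow_eq]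

instance : (volume : Measure (Config d s)).IsAddHaarMeasure :=
  Measure.prod.instIsAddHaarMeasure _ _

lemma measurePreserving_reverse : MeasurePreserving (reverse : Config d s → Config d s) :=
  haveI : (volume : Measure (Fin s → EuclideanSpace ℝ (Fin d))).IsNegInvariant :=
    Measure.pi.isNegInvariant fun _ => volume
  (MeasurePreserving.id volume).prod (Measure.measurePreserving_neg volume)

end PhaseSpaceMaps

/-! ### One time step does not increase the volume of pulled-back sets. -/

section StepMeasure

/-- An involution with unit Jacobian does not increase the measure of preimages. -/
lemma measure_preimage_le_of_involution {F : Type*} [NormedAddCommGroup F] [NormedSpace ℝ F]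
    [FiniteDimensional ℝ F] [MeasurableSpace F] [BorelSpace F] (μ : Measure F) [μ.IsAddHaarMeasure]
    {W : F → F} {K U : Set F} (hK : MeasurableSet K) (hU : MeasurableSet U)
    (hW : ∀ Z ∈ K, ∃ L : F →L[ℝ] F, HasFDerivAt W L Z ∧ |L.det| = 1) (hi : ∀ Z ∈ K, W (W Z) = Z) :
    μ {Z | Z ∈ K ∧ W Z ∈ K ∧ W Z ∈ U} ≤ μ (K ∩ U) := by
  choose! L hL hdet using hW
  calc μ {Z | Z ∈ K ∧ W Z ∈ K ∧ W Z ∈ U} ≤ μ (W '' (K ∩ U)) :=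
        measure_mono fun Z hZ => ⟨W Z, hZ.2, hi Z hZ.1⟩
    _ ≤ ∫⁻ Z in K ∩ U, ENNReal.ofReal |(L Z).det| ∂μ :=
        addHaar_image_le_lintegral_abs_det_fderiv μ (hK.inter hU)
          fun Z hZ => (hL Z hZ.1).hasFDerivWithinAt
    _ = ∫⁻ Z in K ∩ U, 1 ∂μ :=
        setLIntegral_congr_fun (hK.inter hU) fun Z hZ => by simp [hdet Z hZ.1]
    _ = μ (K ∩ U) := by simp

/-- Pairs of particles. -/
abbrev Pair (s : ℕ) : Type := {p : Fin s × Fin s // p.1 < p.2}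

variable {d s : ℕ}

/-- The evolution up to time `δ` with no collision, or with a collision of a given pair. -/
noncomputable def stepMap (ε δ : ℝ) : Option (Pair s) → Config d s → Config d s
  | none => freeFlow δ
  | some p => scatter ε δ p.1.1 p.1.2

/-- No pair collides before time `δ`, or only the given one. -/
def stepDomain (d : ℕ) {s : ℕ} (ε δ : ℝ) (o : Option (Pair s)) : Set (Config d s) :=
  {Z | ∀ p : Pair s, Z ∈ hits d ε δ p.1.1 p.1.2 ↔ o = some p}

lemma measurableSet_stepDomain (ε δ : ℝ) (o : Option (Pair s)) :
    MeasurableSet (stepDomain d ε δ o) := by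
  have : stepDomain d ε δ o = ⋂ p : Pair s, {Z | Z ∈ hits d ε δ p.1.1 p.1.2 ↔ o = some p} := by
    ext Z; simp [stepDomain]
  rw [this]
  refine MeasurableSet.iInter fun p => ?_
  by_cases h : o = some p
  · simpa [h] using measurableSet_hits ε δ p.1.1 p.1.2
  · simp only [h, iff_false]
    exact (measurableSet_hits ε δ p.1.1 p.1.2).compl

lemma disjoint_stepDomain (ε δ : ℝ) :
    Pairwise fun o o' : Option (Pair s) => Disjoint (stepDomain d ε δ o) (stepDomain d ε δ o') := by
  intro o o' hne
  refine Set.disjoint_left.2 fun Z h h' => hne ?_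
  rcases o with _ | p
  · rcases o' with _ | p'
    · rfl
    · simpa using (h p').1 ((h' p').2 rfl)
  · exact ((h' p).1 ((h p).2 rfl)).symm

/-- Each branch is bounded by the part of the reversed `U` inside its own domain. These domains are
disjoint, so summing over branches costs no factor; the constant `1` is essential because the
estimate is iterated `m` times. -/
lemma measure_stepMap_preimage_le {ε δ : ℝ} (hε : 0 < ε) {U : Set (Config d s)}
    (hU : MeasurableSet U) :
    volume {Z : Config d s | ∃ o, Z ∈ stepDomain d ε δ o ∧
      reverse (stepMap ε δ o Z) ∈ stepDomain d ε δ o ∧ stepMap ε δ o Z ∈ U} ≤ volume U := by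
  have hU' : MeasurableSet ((reverse : Config d s → Config d s) ⁻¹' U) :=
    measurePreserving_reverse.measurable hU
  have key : ∀ o : Option (Pair s), volume {Z : Config d s | Z ∈ stepDomain d ε δ o ∧
      reverse (stepMap ε δ o Z) ∈ stepDomain d ε δ o ∧ reverse (stepMap ε δ o Z) ∈ reverse ⁻¹' U} ≤
      volume (stepDomain d ε δ o ∩ reverse ⁻¹' U) := by
    intro o
    refine measure_preimage_le_of_involution volume (W := fun Z => reverse (stepMap ε δ o Z))
      (measurableSet_stepDomain ε δ o) hU' ?_ ?_
    · intro Z hZ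
      rcases o with _ | p
      · exact freeFlow_hasFDerivAt δ Z
      · exact scatter_hasFDerivAt hε p.2.ne ((hZ p).2 rfl)
    · intro Z hZ
      rcases o with _ | p
      · exact reverse_freeFlow_involutive δ Z
      · exact (reverse_scatter_involutive hε p.2.ne ((hZ p).2 rfl)).2
  calc _ ≤ volume (⋃ o, {Z : Config d s | Z ∈ stepDomain d ε δ o ∧
      reverse (stepMap ε δ o Z) ∈ stepDomain d ε δ o ∧ reverse (stepMap ε δ o Z) ∈ reverse ⁻¹' U}) := by
        refine measure_mono ?_
        rintro Z ⟨o, h1, h2, h3⟩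
        exact Set.mem_iUnion.2 ⟨o, h1, h2, by rwa [Set.mem_preimage, reverse_reverse]⟩
    _ ≤ ∑ o, volume (stepDomain d ε δ o ∩ reverse ⁻¹' U) :=
        (measure_iUnion_fintype_le _ _).trans (Finset.sum_le_sum fun o _ => key o)
    _ = volume (⋃ o, stepDomain d ε δ o ∩ reverse ⁻¹' U) := by
        rw [measure_iUnion, tsum_fintype]
        · exact fun o o' h => (disjoint_stepDomain ε δ h).mono Set.inter_subset_left
            Set.inter_subset_left
        · exact fun o => (measurableSet_stepDomain ε δ o).inter hU'
    _ ≤ volume ((reverse : Config d s → Config d s) ⁻¹' U) :=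
        measure_mono (Set.iUnion_subset fun o => Set.inter_subset_right)
    _ = volume U := measurePreserving_reverse.measure_preimage hU.nullMeasurableSet

end StepMeasure

/-! ### Two simultaneous near-contacts have volume quadratic in the width. -/

section Shells

/-- The shell `ε < ‖x‖ ≤ ε + η`. -/
def shell (d : ℕ) (ε η : ℝ) : Set (EuclideanSpace ℝ (Fin d)) := {x | ε < ‖x‖ ∧ ‖x‖ ≤ ε + η}

lemma add_pow_le_pow_add {ε η : ℝ} (hε : 0 ≤ ε) (h0 : 0 ≤ η) (h1 : η ≤ 1) (n : ℕ) :
    (ε + η) ^ n ≤ ε ^ n + η * (n * (ε + 1) ^ n) := by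
  induction n with
  | zero => simp
  | succ n ih =>
    have a1 : ε ^ n * η ≤ η * (ε + 1) ^ (n + 1) := by
      rw [mul_comm]
      refine mul_le_mul_of_nonneg_left ?_ h0
      calc ε ^ n ≤ (ε + 1) ^ n := by gcongr; linarith
        _ ≤ (ε + 1) ^ (n + 1) := pow_le_pow_right₀ (by linarith) (Nat.le_succ n)
    have a2 : η * (n * (ε + 1) ^ n) * (ε + η) ≤ η * (n * (ε + 1) ^ n) * (ε + 1) := by
      gcongr
    calc (ε + η) ^ (n + 1) = (ε + η) ^ n * (ε + η) := pow_succ _ _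
      _ ≤ (ε ^ n + η * (n * (ε + 1) ^ n)) * (ε + η) := by gcongr
      _ ≤ ε ^ (n + 1) + η * ((n + 1 : ℕ) * (ε + 1) ^ (n + 1)) := by
        push_cast
        simp only [pow_succ] at *
        nlinarith

lemma exists_volume_shell_le (d : ℕ) {ε : ℝ} (hε : 0 < ε) :
    ∃ C : ENNReal, C ≠ ⊤ ∧ ∀ η : ℝ, 0 ≤ η → η ≤ 1 →
      volume (shell d ε η) ≤ C * ENNReal.ofReal η := by
  refine ⟨ENNReal.ofReal (d * (ε + 1) ^ d) *
      volume (Metric.ball (0 : EuclideanSpace ℝ (Fin d)) 1),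
    ENNReal.mul_ne_top ENNReal.ofReal_ne_top measure_ball_lt_top.ne, fun η h0 h1 => ?_⟩
  have e : shell d ε η = Metric.closedBall 0 (ε + η) \ Metric.closedBall 0 ε := by
    ext x
    simp [shell, and_comm]
  rw [e, measure_sdiff (Metric.closedBall_subset_closedBall (by linarith))
    Metric.isClosed_closedBall.measurableSet.nullMeasurableSet measure_closedBall_lt_top.ne,
    Measure.addHaar_closedBall _ _ (by positivity), Measure.addHaar_closedBall _ _ hε.le,
    finrank_euclideanSpace_fin, tsub_le_iff_left]
  calc _ ≤ ENNReal.ofReal (ε ^ d + η * (d * (ε + 1) ^ d)) *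
        volume (Metric.ball (0 : EuclideanSpace ℝ (Fin d)) 1) := by
        gcongr
        exact add_pow_le_pow_add hε.le h0 h1 d
    _ = _ := by
        rw [ENNReal.ofReal_add (by positivity) (by positivity), ENNReal.ofReal_mul h0]
        ring

/-- Replacing `X j` and `X l` by the two relative positions is a linear change of variables. It is
triangular, hence invertible, because `l` is outside the first pair; `k` may still belong to that
pair. -/
lemma exists_volume_two_relative_le {d s : ℕ} (K : ℝ) {i j k l : Fin s} (hij : i ≠ j) (hkl : k ≠ l)
    (hil : i ≠ l) (hjl : j ≠ l) :
    ∃ C : ENNReal, C ≠ ⊤ ∧ ∀ S : Set (EuclideanSpace ℝ (Fin d)),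
      volume {X : Fin s → EuclideanSpace ℝ (Fin d) |
        (∀ m, ‖X m‖ ≤ K) ∧ X j - X i ∈ S ∧ X l - X k ∈ S} ≤ C * volume S ^ 2 := by
  let E := EuclideanSpace ℝ (Fin d)
  let pr : Fin s → (Fin s → E) →ₗ[ℝ] E := fun m => LinearMap.proj m
  let L : (Fin s → E) →ₗ[ℝ] (Fin s → E) := LinearMap.pi fun m =>
    if m = l then pr l - pr k else if m = j then pr j - pr i else pr m
  have hLl : ∀ X, L X l = X l - X k := fun X => by simp [L, pr]
  have hLj : ∀ X, L X j = X j - X i := fun X => by simp [L, pr, hjl]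
  have hLm : ∀ X m, m ≠ l → m ≠ j → L X m = X m := fun X m h1 h2 => by simp [L, pr, h1, h2]
  have hinj : LinearMap.ker L = ⊥ := by
    rw [LinearMap.ker_eq_bot']
    intro X hX
    have h1 : ∀ m, m ≠ l → m ≠ j → X m = 0 := fun m a b => by rw [← hLm X m a b, hX]; rfl
    have hj : X j = 0 := by
      have := hLj X
      rw [hX, h1 i hil hij, sub_zero] at this
      exact this.symm
    have h2 : ∀ m, m ≠ l → X m = 0 := fun m a => by
      by_cases b : m = j
      · rw [b, hj]
      · exact h1 m a b
    have hl : X l = 0 := by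
      have := hLl X
      rw [hX, h2 k hkl, sub_zero] at this
      exact this.symm
    ext1 m
    by_cases a : m = l
    · rw [a, hl]; rfl
    · exact h2 m a
  have hdet : LinearMap.det L ≠ 0 := by
    have := LinearMap.isUnit_det L ((LinearMap.isUnit_iff_ker_eq_bot L).2 hinj)
    exact this.ne_zero
  refine ⟨ENNReal.ofReal |(LinearMap.det L)⁻¹| *
    volume (Metric.closedBall (0 : E) K) ^ (Finset.univ.filter fun m => ¬(m = l ∨ m = j)).card,
    ENNReal.mul_ne_top ENNReal.ofReal_ne_top (ENNReal.pow_ne_top measure_closedBall_lt_top.ne),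
    fun S => ?_⟩
  have hsub : {X : Fin s → E | (∀ m, ‖X m‖ ≤ K) ∧ X j - X i ∈ S ∧ X l - X k ∈ S} ⊆
      L ⁻¹' (Set.univ.pi fun m => if m = l ∨ m = j then S else Metric.closedBall 0 K) := by
    rintro X ⟨hK, h1, h2⟩ m -
    by_cases a : m = l
    · subst a
      simpa [hLl] using h2
    · by_cases b : m = j
      · subst b
        simpa [hLj] using h1
      · simpa [a, b, hLm X m a b] using hK m
  refine (measure_mono hsub).trans ?_
  rw [Measure.addHaar_preimage_linearMap _ hdet, volume_pi_pi]
  have hcard : (Finset.univ.filter fun m => m = l ∨ m = j).card = 2 := by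
    have : (Finset.univ.filter fun m => m = l ∨ m = j) = {l, j} := by ext; simp
    rw [this, Finset.card_pair hjl.symm]
  simp only [apply_ite volume]
  rw [Finset.prod_ite, Finset.prod_const, Finset.prod_const, hcard]
  exact le_of_eq (by ring)

/-- Two different pairs of particles are at distance at most `ε + η`. -/
def twoClosePairs (d s : ℕ) (ε K R η : ℝ) : Set (Config d s) :=
  {Z | (∀ m, ‖Z.1 m‖ ≤ K) ∧ (∀ m, ‖Z.2 m‖ ≤ R) ∧ ∃ p q : Pair s, p ≠ q ∧
    Z.1 p.1.2 - Z.1 p.1.1 ∈ shell d ε η ∧ Z.1 q.1.2 - Z.1 q.1.1 ∈ shell d ε η}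

lemma neg_mem_shell {d : ℕ} {ε η : ℝ} {x : EuclideanSpace ℝ (Fin d)} (h : x ∈ shell d ε η) :
    -x ∈ shell d ε η := by simpa [shell] using h

lemma exists_volume_twoClosePairs_le (d s : ℕ) {ε : ℝ} (hε : 0 < ε) (K R : ℝ) :
    ∃ C : ENNReal, C ≠ ⊤ ∧ ∀ η : ℝ, 0 ≤ η → η ≤ 1 →
      volume (twoClosePairs d s ε K R η) ≤ C * ENNReal.ofReal η ^ 2 := by
  obtain ⟨C₁, hC₁, hS⟩ := exists_volume_shell_le d hε
  let ι := {t : (Fin s × Fin s) × (Fin s × Fin s) //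
    t.1.1 ≠ t.1.2 ∧ t.2.1 ≠ t.2.2 ∧ t.1.1 ≠ t.2.2 ∧ t.1.2 ≠ t.2.2}
  have h := fun t : ι => exists_volume_two_relative_le (d := d) K t.2.1 t.2.2.1 t.2.2.2.1 t.2.2.2.2
  choose C hC hCS using h
  let b := volume (Set.univ.pi fun _ : Fin s => Metric.closedBall (0 : EuclideanSpace ℝ (Fin d)) R)
  have hb : b ≠ ⊤ := by
    simp only [b, volume_pi_pi]
    exact ENNReal.prod_ne_top fun _ _ => measure_closedBall_lt_top.ne
  refine ⟨(∑ t : ι, C t) * C₁ ^ 2 * b, ENNReal.mul_ne_top (ENNReal.mul_ne_top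
    (ENNReal.sum_ne_top.2 fun t _ => hC t) (ENNReal.pow_ne_top hC₁)) hb, fun η h0 h1 => ?_⟩
  have hsub : twoClosePairs d s ε K R η ⊆
      (⋃ t : ι, {X : Fin s → EuclideanSpace ℝ (Fin d) | (∀ m, ‖X m‖ ≤ K) ∧
        X t.1.1.2 - X t.1.1.1 ∈ shell d ε η ∧ X t.1.2.2 - X t.1.2.1 ∈ shell d ε η}) ×ˢ
      (Set.univ.pi fun _ : Fin s => Metric.closedBall 0 R) := by
    rintro Z ⟨hK, hR, p, q, hpq, hp, hq⟩
    refine ⟨Set.mem_iUnion.2 ?_, fun m _ => by simpa using hR m⟩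
    obtain ⟨⟨i, j⟩, hij⟩ := p
    obtain ⟨⟨k, l⟩, hkl⟩ := q
    have hne : ¬(i = k ∧ j = l) := fun h => hpq (by simp [h.1, h.2])
    dsimp only at hij hkl hp hq
    -- Two different pairs share at most one particle, so some end of the second lies outside the
    -- first. If that end is `k`, the pair is turned around, the shell being symmetric.
    by_cases hl : i ≠ l ∧ j ≠ l
    · exact ⟨⟨((i, j), (k, l)), hij.ne, hkl.ne, hl.1, hl.2⟩, hK, hp, hq⟩
    · have hk : i ≠ k ∧ j ≠ k := by
        simp only [Fin.ext_iff, ne_eq] at *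
        omega
      exact ⟨⟨((i, j), (l, k)), hij.ne, hkl.ne', hk.1, hk.2⟩, hK, hp, by
        simpa using neg_mem_shell hq⟩
  calc volume (twoClosePairs d s ε K R η) ≤ _ := measure_mono hsub
    _ = volume (⋃ t : ι, {X : Fin s → EuclideanSpace ℝ (Fin d) | (∀ m, ‖X m‖ ≤ K) ∧
        X t.1.1.2 - X t.1.1.1 ∈ shell d ε η ∧ X t.1.2.2 - X t.1.2.1 ∈ shell d ε η}) * b :=
        Measure.prod_prod _ _
    _ ≤ (∑ t : ι, C t * (C₁ * ENNReal.ofReal η) ^ 2) * b := by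
        gcongr
        refine (measure_iUnion_fintype_le _ _).trans (Finset.sum_le_sum fun t _ => ?_)
        exact (hCS t _).trans (by gcongr; exact hS η h0 h1)
    _ = _ := by rw [← Finset.sum_mul]; ring

end Shells

/-! ### Grazing trajectories and the removal of particles. -/

section NullSets

variable {d s : ℕ}

/-- Fubini twice: first over positions, then over velocities along lines whose direction may depend
on the positions. -/
lemma volume_eq_zero_of_finite_lines {S : Set (Config d s)} (hS : MeasurableSet S)
    (h : ∀ X : Fin s → EuclideanSpace ℝ (Fin d), ∃ U : Fin s → EuclideanSpace ℝ (Fin d),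
      ∀ V, {c : ℝ | (X, V + c • U) ∈ S}.Finite) : volume S = 0 := by
  refine (Measure.measure_prod_null hS).2 (Eventually.of_forall fun X => ?_)
  obtain ⟨U, hU⟩ := h X
  have hm : MeasurableSet (Prod.mk X ⁻¹' S)ᶜ := (measurable_prodMk_left hS).compl
  have := (ae_ae_add_linearMap_mem_iff ((LinearMap.id : ℝ →ₗ[ℝ] ℝ).smulRight U) volume volume hm).1
    (Eventually.of_forall fun V => by
      rw [ae_iff]
      have : {c : ℝ | ¬ V + ((LinearMap.id : ℝ →ₗ[ℝ] ℝ).smulRight U) c ∈ (Prod.mk X ⁻¹' S)ᶜ} =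
          {c : ℝ | (X, V + c • U) ∈ S} := by
        ext c; simp
      rw [this]
      exact (hU V).measure_zero _)
  rw [ae_iff] at this
  refine measure_mono_null (fun V hV => ?_) this
  simpa using hV

lemma finite_setOf_quadratic_eq_zero {a : ℝ} (ha : a ≠ 0) (b c : ℝ) :
    {t : ℝ | a * t ^ 2 + b * t + c = 0}.Finite := by
  have hp : (Polynomial.C a * Polynomial.X ^ 2 + Polynomial.C b * Polynomial.X +
      Polynomial.C c) ≠ 0 := by
    intro h
    have := congrArg (fun p => Polynomial.coeff p 2) h
    exact ha (by simpa [Polynomial.coeff_X, Polynomial.coeff_C] using this)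
  refine (Polynomial.finite_setOfPred_isRoot hp).subset fun t ht => ?_
  simpa [Polynomial.IsRoot] using ht

/-- The particles `i`, `j` would graze each other, or touch at time `δ`. -/
def grazing (d : ℕ) {s : ℕ} (ε δ : ℝ) (i j : Fin s) : Set (Config d s) :=
  {Z | ε < ‖Z.1 j - Z.1 i‖ ∧ (disc ε (Z.1 j - Z.1 i) (Z.2 j - Z.2 i) = 0 ∨
    ‖Z.1 j - Z.1 i + δ • (Z.2 j - Z.2 i)‖ = ε)}

/-- Adding `c` times the relative position to the velocity of particle `j` turns both conditions
into quadratic equations in `c`, with leading coefficients `‖x‖ ^ 2 * ε ^ 2` and `δ ^ 2 * ‖x‖ ^ 2`.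
-/
lemma volume_grazing {ε δ : ℝ} (hε : 0 < ε) (hδ : 0 < δ) {i j : Fin s} (hij : i ≠ j) :
    volume (grazing d ε δ i j) = 0 := by
  refine volume_eq_zero_of_finite_lines ?_ fun X => ⟨Pi.single j (X j - X i), fun V => ?_⟩
  · have h1 : Measurable fun Z : Config d s => Z.1 j - Z.1 i := by fun_prop
    have h3 : Measurable fun Z : Config d s => disc ε (Z.1 j - Z.1 i) (Z.2 j - Z.2 i) := by
      simp only [disc]; fun_prop
    have h4 : Measurable fun Z : Config d s => ‖Z.1 j - Z.1 i + δ • (Z.2 j - Z.2 i)‖ := by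
      fun_prop
    exact (measurableSet_lt measurable_const h1.norm).inter
      ((measurableSet_eq_fun h3 measurable_const).union (measurableSet_eq_fun h4 measurable_const))
  · by_cases hx : ε < ‖X j - X i‖
    swap
    · simp [grazing, hx]
    set x := X j - X i
    set v := V j - V i
    have hx0 : 0 < ‖x‖ := hε.trans hx
    have hv : ∀ c : ℝ, (V + c • (Pi.single j x : Fin s → EuclideanSpace ℝ (Fin d))) j -
        (V + c • (Pi.single j x : Fin s → EuclideanSpace ℝ (Fin d))) i = v + c • x := by
      intro c
      simp [hij, v]
      abel
    refine ((finite_setOf_quadratic_eq_zero (a := ‖x‖ ^ 2 * ε ^ 2) (by positivity)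
      (2 * inner ℝ x v * ε ^ 2) (disc ε x v)).union
        (finite_setOf_quadratic_eq_zero (a := δ ^ 2 * ‖x‖ ^ 2) (by positivity)
          (2 * δ * (‖x‖ ^ 2 + δ * inner ℝ x v)) (‖x + δ • v‖ ^ 2 - ε ^ 2))).subset ?_
    rintro c ⟨-, hc⟩
    dsimp only at hc
    rw [hv] at hc
    rcases hc with hc | hc
    · left
      rw [disc, norm_add_smul_sq, inner_add_right, inner_smul_right, real_inner_self_eq_norm_sq] at hc
      rw [Set.mem_ofPred_eq, disc]
      have := real_inner_comm x v
      rw [this] at hc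
      linear_combination hc
    · right
      have e : x + δ • (v + c • x) = (x + δ • v) + (δ * c) • x := by module
      have h2 : ‖x + δ • (v + c • x)‖ ^ 2 = ε ^ 2 := by rw [hc]
      rw [e, norm_add_smul_sq (x + δ • v), inner_add_left, real_inner_self_eq_norm_sq,
        real_inner_smul_left, real_inner_comm] at h2
      rw [Set.mem_ofPred_eq]
      linear_combination h2

/-- The map removing a particle pulls null sets back to null sets. -/
lemma volume_preimage_erase {n : ℕ} (k : Fin (n + 1)) {S : Set (Config d n)}
    (hS : volume S = 0) : volume (erase k ⁻¹' S) = 0 := by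
  have h1 : Measure.QuasiMeasurePreserving
      (fun X : Fin (n + 1) → EuclideanSpace ℝ (Fin d) => fun m : Fin n => X (k.succAbove m)) := by
    exact (Measure.quasiMeasurePreserving_snd).comp
      (volume_preserving_piFinSuccAbove (fun _ => EuclideanSpace ℝ (Fin d)) k).quasiMeasurePreserving
  exact (QuasiMeasurePreserving.prodMap h1 h1).preimage_null hS

end NullSets

/-! ### Transport and jump condition across one collision. -/

section Collision

variable {d s n : ℕ}

lemma rel_collide_inner {ε : ℝ} (hε : 0 < ε) {i j : Fin s} (hij : i ≠ j) {Y : Config d s}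
    (hY : ‖Y.1 i - Y.1 j‖ = ε) :
    inner ℝ ((collide ε i j Y).1 j - (collide ε i j Y).1 i)
      ((collide ε i j Y).2 j - (collide ε i j Y).2 i) =
    -inner ℝ (Y.1 j - Y.1 i) (Y.2 j - Y.2 i) := by
  have hyy : inner ℝ (Y.1 j - Y.1 i) (Y.1 j - Y.1 i) = ε ^ 2 := by
    rw [real_inner_self_eq_norm_sq, norm_sub_rev, hY]
  rw [← relCLM_apply i j (collide ε i j Y).2, ← relCLM_apply i j (collide ε i j Y).1,
    collide_eq ε hij]
  simp only [map_add, map_smul, rel_transfer hij, relCLM_apply, inner_add_right, inner_smul_right,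
    hyy]
  field_simp
  ring

lemma collide_collide {ε : ℝ} (hε : 0 < ε) {i j : Fin s} (hij : i ≠ j) {Y : Config d s}
    (hY : ‖Y.1 i - Y.1 j‖ = ε) : collide ε i j (collide ε i j Y) = Y := by
  have h := rel_collide_inner hε hij hY
  rw [← relCLM_apply, ← relCLM_apply] at h
  rw [collide_eq ε hij (collide ε i j Y), h]
  simp only [collide_eq ε hij, relCLM_apply]
  ext1
  · rfl
  · dsimp only
    module

lemma dotForm_collide {ε : ℝ} (hε : 0 < ε) {i j : Fin s} (hij : i ≠ j) {Y : Config d s}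
    (hY : ‖Y.1 i - Y.1 j‖ = ε) :
    dotForm d s (collide ε i j Y).2 (collide ε i j Y).2 = dotForm d s Y.2 Y.2 := by
  have hyy : inner ℝ (Y.1 j - Y.1 i) (Y.1 j - Y.1 i) = ε ^ 2 := by
    rw [real_inner_self_eq_norm_sq, norm_sub_rev, hY]
  rw [collide_eq ε hij]
  simp only [map_add, map_smul, LinearMap.add_apply, LinearMap.smul_apply, smul_eq_mul,
    dotForm_transfer, dotForm_comm Y.2 (transferCLM _ _ _ _), rel_transfer hij, inner_smul_right,
    relCLM_apply, hyy]
  field_simp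
  ring

lemma erase_mem_phaseSpace {ε : ℝ} {Z : Config d (n + 1)} (hZ : Z ∈ phaseSpace d ε (n + 1))
    (k : Fin (n + 1)) : erase k Z ∈ phaseSpace d ε n :=
  fun _ _ hab => hZ _ _ ((Fin.strictMono_succAbove k) hab)

lemma erase_mem_phaseSpace_of_contact {ε : ℝ} {i j : Fin (n + 1)} {Z : Config d (n + 1)}
    (hZ : Z ∈ contact d ε (n + 1) i j) {k : Fin (n + 1)} (hk : k = i ∨ k = j) :
    erase k Z ∈ phaseSpace d ε n := by
  intro a b hab
  refine hZ.2 _ _ ((Fin.strictMono_succAbove k) hab).ne ?_ ?_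
  · rintro ⟨h1, h2⟩
    rcases hk with rfl | rfl
    · exact Fin.succAbove_ne _ _ h1
    · exact Fin.succAbove_ne _ _ h2
  · rintro ⟨h1, h2⟩
    rcases hk with rfl | rfl
    · exact Fin.succAbove_ne _ _ h2
    · exact Fin.succAbove_ne _ _ h1

lemma freeFlow_zero (Z : Config d s) : freeFlow 0 Z = Z := by simp [freeFlow_eq]

variable {N : ℕ} {ε : ℝ} {φ : (s : ℕ) → ℝ → Config d s → ℝ}

/-- Removing one of the two touching particles removes the only contact, so the reduced trajectory
stays in the interior up to and including the collision time. This carries the lower-order terms of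
the jump condition to the start of the step. -/
lemma IsSolution.erase_before (h : IsSolution d N ε φ) (hn : 1 ≤ n) (hnN : n ≤ N)
    {i j k : Fin (n + 1)} (hk : k = i ∨ k = j) {Z : Config d (n + 1)} {t τ : ℝ} (ht : 0 ≤ t)
    (hτ : 0 < τ) (hZ : ∀ u, 0 ≤ u → u < τ → freeFlow u Z ∈ phaseSpace d ε (n + 1))
    (hY : freeFlow τ Z ∈ contact d ε (n + 1) i j) :
    φ n (t + τ) (erase k Z) = φ n t (erase k (freeFlow τ Z)) := by
  refine h.transport n hn hnN (erase k Z) t τ ht hτ (Or.inl ?_) (Or.inl ?_) ?_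
  · have := erase_mem_phaseSpace (hZ 0 le_rfl hτ) k
    rwa [freeFlow_zero] at this
  · exact erase_mem_phaseSpace_of_contact hY hk
  · exact fun u hu => erase_mem_phaseSpace (hZ u hu.1.le hu.2) k

lemma IsSolution.erase_after (h : IsSolution d N ε φ) (hn : 1 ≤ n) (hnN : n ≤ N)
    {i j k : Fin (n + 1)} (hk : k = i ∨ k = j) {Z : Config d (n + 1)} {t τ : ℝ} (ht : 0 ≤ t)
    (hτ : 0 < τ) (hY : Z ∈ contact d ε (n + 1) i j)
    (hZ : ∀ u, 0 < u → u ≤ τ → freeFlow u Z ∈ phaseSpace d ε (n + 1)) :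
    φ n (t + τ) (erase k Z) = φ n t (erase k (freeFlow τ Z)) := by
  refine h.transport n hn hnN (erase k Z) t τ ht hτ (Or.inl ?_) (Or.inl ?_) ?_
  · exact erase_mem_phaseSpace_of_contact hY hk
  · exact erase_mem_phaseSpace (hZ τ hτ le_rfl) k
  · exact fun u hu => erase_mem_phaseSpace (hZ u hu.1 hu.2.le) k

/-- The evolution of a solution of the hierarchy through one collision. -/
lemma IsSolution.through_collision (h : IsSolution d N ε φ) (hε : 0 < ε) (hn : 1 ≤ n)
    (hnN : n + 1 ≤ N) {i j : Fin (n + 1)} (hij : i ≠ j) {Z : Config d (n + 1)} {t τ σ : ℝ}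
    (ht : 0 ≤ t) (hτ : 0 < τ) (hσ : 0 < σ)
    (hZ : ∀ u, 0 ≤ u → u < τ → freeFlow u Z ∈ phaseSpace d ε (n + 1))
    (hY : freeFlow τ Z ∈ contact d ε (n + 1) i j)
    (hin : inner ℝ ((freeFlow τ Z).1 j - (freeFlow τ Z).1 i)
      ((freeFlow τ Z).2 j - (freeFlow τ Z).2 i) < 0)
    (hZ' : ∀ u, 0 < u → u ≤ σ →
      freeFlow u (collide ε i j (freeFlow τ Z)) ∈ phaseSpace d ε (n + 1)) :
    φ (n + 1) (t + (σ + τ)) Z = φ (n + 1) t (freeFlow σ (collide ε i j (freeFlow τ Z))) +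
      ((N : ℝ) - n) * (φ n (t + (σ + τ)) (erase i Z) + φ n (t + (σ + τ)) (erase j Z) +
        φ n t (erase i (freeFlow σ (collide ε i j (freeFlow τ Z)))) +
        φ n t (erase j (freeFlow σ (collide ε i j (freeFlow τ Z))))) := by
  set Y := freeFlow τ Z
  have hYc : collide ε i j Y ∈ contact d ε (n + 1) i j := hY
  have hYin := rel_collide_inner hε hij hY.1
  have hcc := collide_collide hε hij hY.1
  have hpost : collide ε i j Y ∈ postContact d ε (n + 1) i j := ⟨hYc, by rw [hYin]; linarith⟩
  have e1 : φ (n + 1) (t + (σ + τ)) Z = φ (n + 1) (t + σ) Y := by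
    rw [← add_assoc]
    refine h.transport (n + 1) (by omega) hnN Z (t + σ) τ (by linarith) hτ (Or.inl ?_)
      (Or.inr ⟨i, j, hij, hY, hin.ne⟩) fun u hu => hZ u hu.1.le hu.2
    have := hZ 0 le_rfl hτ
    rwa [freeFlow_zero] at this
  have e2 : φ (n + 1) (t + σ) (collide ε i j Y) =
      φ (n + 1) t (freeFlow σ (collide ε i j Y)) :=
    h.transport (n + 1) (by omega) hnN _ t σ ht hσ (Or.inr ⟨i, j, hij, hYc, hpost.2.ne'⟩)
      (Or.inl (hZ' σ hσ le_rfl)) fun u hu => hZ' u hu.1 hu.2.le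
  -- The jump condition is posed at outgoing points, so it is used at the collided configuration,
  -- whose own image is the incoming `Y`.
  have e3 := h.jump n hn hnN i j hij (t + σ) (by linarith) _ hpost
  rw [hcc] at e3
  have b := fun k hk => h.erase_before hn (by omega) (k := k) hk (t := t + σ) (by linarith) hτ hZ hY
  have a := fun k hk => h.erase_after hn (by omega) (k := k) hk ht hσ hYc hZ'
  have hN : (N : ℝ) - ((n + 1 : ℕ) : ℝ) + 1 = (N : ℝ) - n := by push_cast; ring
  have hN0 : (N : ℝ) - n ≠ 0 := by
    have : ((n + 1 : ℕ) : ℝ) ≤ N := by exact_mod_cast hnN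
    push_cast at this
    linarith
  rw [hN, a i (Or.inl rfl), a j (Or.inr rfl), ← b i (Or.inl rfl), ← b j (Or.inr rfl), e2, ← e1,
    add_assoc] at e3
  field_simp at e3
  linear_combination e3

end Collision

/-! ### Dynamics within one time step. -/

section Step

variable {d s : ℕ} {ε R δ : ℝ}

lemma mem_phaseSpace_iff {Z : Config d s} :
    Z ∈ phaseSpace d ε s ↔ ∀ p : Pair s, ε < ‖Z.1 p.1.2 - Z.1 p.1.1‖ :=
  ⟨fun h p => by rw [norm_sub_rev]; exact h _ _ p.2,
    fun h i j hij => by rw [norm_sub_rev]; exact h ⟨(i, j), hij⟩⟩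

lemma mem_contact {Z : Config d s} {p : Pair s} (h : ‖Z.1 p.1.2 - Z.1 p.1.1‖ = ε)
    (h' : ∀ q : Pair s, q ≠ p → ε < ‖Z.1 q.1.2 - Z.1 q.1.1‖) :
    Z ∈ contact d ε s p.1.1 p.1.2 := by
  refine ⟨by rwa [norm_sub_rev], fun k l hkl h1 h2 => ?_⟩
  rcases hkl.lt_or_gt with hlt | hlt
  · rw [norm_sub_rev]
    exact h' ⟨(k, l), hlt⟩ fun hp => h1 ⟨by rw [← hp], by rw [← hp]⟩
  · exact h' ⟨(l, k), hlt⟩ fun hp => h2 ⟨by rw [← hp], by rw [← hp]⟩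

lemma norm_le_of_energy (hR : 0 ≤ R) {V : Fin s → EuclideanSpace ℝ (Fin d)}
    (h : dotForm d s V V ≤ R ^ 2) (k : Fin s) : ‖V k‖ ≤ R := by
  rw [dotForm_apply] at h
  have : inner ℝ (V k) (V k) ≤ ∑ m, inner ℝ (V m) (V m) :=
    Finset.single_le_sum (f := fun m => inner ℝ (V m) (V m)) (fun m _ => real_inner_self_nonneg)
      (Finset.mem_univ k)
  rw [real_inner_self_eq_norm_sq] at this
  exact (sq_le_sq₀ (norm_nonneg _) hR).1 (this.trans h)

lemma freeFlow_sub_le (hR : 0 ≤ R) {Z : Config d s} (h : dotForm d s Z.2 Z.2 ≤ R ^ 2) {τ : ℝ}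
    (hτ : 0 ≤ τ) (k : Fin s) : ‖(freeFlow τ Z).1 k - Z.1 k‖ ≤ τ * R := by
  simp only [freeFlow, add_sub_cancel_left, norm_smul, Real.norm_eq_abs, abs_of_nonneg hτ]
  exact mul_le_mul_of_nonneg_left (norm_le_of_energy hR h k) hτ

lemma norm_rel_le {X X' : Fin s → EuclideanSpace ℝ (Fin d)} {a : ℝ} (h : ∀ k, ‖X' k - X k‖ ≤ a)
    (i j : Fin s) : ‖X j - X i‖ ≤ ‖X' j - X' i‖ + 2 * a := by
  have e : X j - X i = (X' j - X' i) - (X' j - X j) + (X' i - X i) := by abel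
  have h1 := norm_add_le ((X' j - X' i) - (X' j - X j)) (X' i - X i)
  have h2 := norm_sub_le (X' j - X' i) (X' j - X j)
  rw [e]
  linarith [h i, h j]

lemma norm_le_of_mem_hits (hε : 0 < ε) (hR : 0 ≤ R) {i j : Fin s} {Z : Config d s}
    (hE : dotForm d s Z.2 Z.2 ≤ R ^ 2) (h : Z ∈ hits d ε δ i j) :
    ‖Z.1 j - Z.1 i‖ ≤ ε + 2 * R * δ := by
  have h0 : 0 < hitTime ε (Z.1 j - Z.1 i) (Z.2 j - Z.2 i) := WillHit.hitTime_pos hε h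
  have h1 : hitTime ε (Z.1 j - Z.1 i) (Z.2 j - Z.2 i) < δ := h.2.2.2
  have h2 : ‖Z.1 j - Z.1 i + hitTime ε (Z.1 j - Z.1 i) (Z.2 j - Z.2 i) • (Z.2 j - Z.2 i)‖ = ε :=
    WillHit.norm_hit hε h
  have h3 := norm_rel_le (freeFlow_sub_le hR hE h0.le) i j
  have e : ∀ τ : ℝ, (freeFlow τ Z).1 j - (freeFlow τ Z).1 i =
      Z.1 j - Z.1 i + τ • (Z.2 j - Z.2 i) := fun τ => by
    simp only [freeFlow]; module
  rw [e, h2] at h3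
  nlinarith

lemma freeFlow_rel (τ : ℝ) (Z : Config d s) (i j : Fin s) :
    (freeFlow τ Z).1 j - (freeFlow τ Z).1 i = Z.1 j - Z.1 i + τ • (Z.2 j - Z.2 i) := by
  simp only [freeFlow]; module

/-- Away from grazing trajectories, nothing happens up to time `δ` if no pair collides. -/
lemma step_none (hε : 0 < ε) {Z : Config d s} (hZ : Z ∈ phaseSpace d ε s)
    (hg : ∀ p : Pair s, Z ∉ grazing d ε δ p.1.1 p.1.2)
    (hh : ∀ p : Pair s, Z ∉ hits d ε δ p.1.1 p.1.2) :
    (∀ u, 0 ≤ u → u ≤ δ → freeFlow u Z ∈ phaseSpace d ε s) ∧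
      reverse (freeFlow δ Z) ∈ stepDomain d ε δ none := by
  have h1 : ∀ u, 0 ≤ u → u ≤ δ → freeFlow u Z ∈ phaseSpace d ε s := by
    intro u h0 hu
    rw [mem_phaseSpace_iff] at hZ ⊢
    intro p
    rw [freeFlow_rel]
    have hgp : ¬(_ ∨ _) := fun hc => hg p ⟨hZ p, hc⟩
    rw [not_or] at hgp
    exact lt_norm_of_not_willHit hε (hZ p) (hh p) hgp.1 hgp.2 h0 hu
  refine ⟨h1, fun p => ⟨fun hp => ?_, fun hp => by simp at hp⟩⟩
  exfalso
  -- A hit of the reversed path at time `τ` would be a contact of the original path at `δ - τ`.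
  set Z' := reverse (freeFlow δ Z)
  set τ := hitTime ε (Z'.1 p.1.2 - Z'.1 p.1.1) (Z'.2 p.1.2 - Z'.2 p.1.1) with hτ
  have h0 : 0 < τ := WillHit.hitTime_pos hε hp
  have h2 : τ < δ := hp.2.2.2
  have h3 : ‖Z'.1 p.1.2 - Z'.1 p.1.1 + τ • (Z'.2 p.1.2 - Z'.2 p.1.1)‖ = ε :=
    WillHit.norm_hit hε hp
  have h4 := mem_phaseSpace_iff.1 (h1 (δ - τ) (by linarith) (by linarith)) p
  have e : (freeFlow (δ - τ) Z).1 p.1.2 - (freeFlow (δ - τ) Z).1 p.1.1 =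
      Z'.1 p.1.2 - Z'.1 p.1.1 + τ • (Z'.2 p.1.2 - Z'.2 p.1.1) := by
    simp only [Z', reverse, freeFlow, Pi.neg_apply]; module
  rw [e, h3] at h4
  exact lt_irrefl _ h4

/-- The course of events up to time `δ` if one pair collides and all others are far apart. -/
lemma step_some (hε : 0 < ε) (hR : 0 ≤ R) {Z : Config d s}
    (hE : dotForm d s Z.2 Z.2 ≤ R ^ 2) {p : Pair s} (hp : Z ∈ hits d ε δ p.1.1 p.1.2)
    (hfar : ∀ q : Pair s, q ≠ p → ε + 6 * R * δ < ‖Z.1 q.1.2 - Z.1 q.1.1‖) {τ : ℝ}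
    (hτ : τ = hitTime ε (Z.1 p.1.2 - Z.1 p.1.1) (Z.2 p.1.2 - Z.2 p.1.1)) :
    (0 < τ ∧ τ < δ) ∧ Z ∈ stepDomain d ε δ (some p) ∧
      reverse (scatter ε δ p.1.1 p.1.2 Z) ∈ stepDomain d ε δ (some p) ∧
      (∀ u, 0 ≤ u → u < τ → freeFlow u Z ∈ phaseSpace d ε s) ∧
      freeFlow τ Z ∈ contact d ε s p.1.1 p.1.2 ∧
      inner ℝ ((freeFlow τ Z).1 p.1.2 - (freeFlow τ Z).1 p.1.1)
        ((freeFlow τ Z).2 p.1.2 - (freeFlow τ Z).2 p.1.1) < 0 ∧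
      (∀ u, 0 < u → u ≤ δ - τ →
        freeFlow u (collide ε p.1.1 p.1.2 (freeFlow τ Z)) ∈ phaseSpace d ε s) ∧
      dotForm d s (scatter ε δ p.1.1 p.1.2 Z).2 (scatter ε δ p.1.1 p.1.2 Z).2 ≤ R ^ 2 ∧
      ∀ k, ‖(scatter ε δ p.1.1 p.1.2 Z).1 k - Z.1 k‖ ≤ δ * R := by
  have hij := p.2.ne
  have h0 : 0 < τ := hτ ▸ WillHit.hitTime_pos hε hp
  have hδ : τ < δ := hτ ▸ hp.2.2.2
  have hnorm : ‖(freeFlow τ Z).1 p.1.2 - (freeFlow τ Z).1 p.1.1‖ = ε := by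
    rw [freeFlow_rel, hτ]; exact WillHit.norm_hit hε hp
  have hin : inner ℝ ((freeFlow τ Z).1 p.1.2 - (freeFlow τ Z).1 p.1.1)
      ((freeFlow τ Z).2 p.1.2 - (freeFlow τ Z).2 p.1.1) < 0 := by
    rw [freeFlow_rel, hτ]
    have h1 : 0 < √(disc ε (Z.1 p.1.2 - Z.1 p.1.1) (Z.2 p.1.2 - Z.2 p.1.1)) :=
      Real.sqrt_pos.2 hp.2.2.1
    refine (WillHit.inner_hit hp).trans_lt ?_
    linarith
  have hsc : scatter ε δ p.1.1 p.1.2 Z =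
      freeFlow (δ - τ) (collide ε p.1.1 p.1.2 (freeFlow τ Z)) := by rw [scatter, ← hτ]
  set Y := freeFlow τ Z with hYdef
  set Y' := collide ε p.1.1 p.1.2 Y with hY'
  have hnorm' : ‖Y.1 p.1.1 - Y.1 p.1.2‖ = ε := by rw [norm_sub_rev, hnorm]
  have hE' : dotForm d s Y'.2 Y'.2 ≤ R ^ 2 := by
    rw [hY', dotForm_collide hε hij hnorm']; exact hE
  have hRδ : 0 ≤ R * δ := mul_nonneg hR (h0.trans hδ).le
  have hfree : ∀ u, 0 ≤ u → u ≤ τ → ∀ q : Pair s, q ≠ p →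
      ε < ‖(freeFlow u Z).1 q.1.2 - (freeFlow u Z).1 q.1.1‖ := by
    intro u hu0 hu q hq
    have := norm_rel_le (freeFlow_sub_le hR hE hu0) q.1.1 q.1.2
    nlinarith [hfar q hq]
  have hmove : ∀ u, 0 ≤ u → u ≤ δ - τ → ∀ k, ‖(freeFlow u Y').1 k - Z.1 k‖ ≤ δ * R := by
    intro u hu0 hu k
    have h1 := freeFlow_sub_le hR hE' hu0 k
    have h2 := freeFlow_sub_le hR hE h0.le k
    have h3 := norm_add_le ((freeFlow u Y').1 k - Y'.1 k) ((freeFlow τ Z).1 k - Z.1 k)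
    have e : (freeFlow u Y').1 k - Y'.1 k + ((freeFlow τ Z).1 k - Z.1 k) =
      (freeFlow u Y').1 k - Z.1 k := sub_add_sub_cancel _ _ _
    rw [e] at h3
    nlinarith
  -- No particle moves farther than `δ * R`, so at least `4 * R * δ` of the margin `6 * R * δ`
  -- survives. A hit within time `δ` needs a margin of at most `2 * R * δ`, so the other pairs hit
  -- neither forwards nor after reversal.
  have hfree' : ∀ u, 0 ≤ u → u ≤ δ - τ → ∀ q : Pair s, q ≠ p →
      ε + 4 * R * δ < ‖(freeFlow u Y').1 q.1.2 - (freeFlow u Y').1 q.1.1‖ := by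
    intro u hu0 hu q hq
    have := norm_rel_le (hmove u hu0 hu) q.1.1 q.1.2
    nlinarith [hfar q hq]
  have hnothit : ∀ {W : Config d s}, dotForm d s W.2 W.2 ≤ R ^ 2 → ∀ q : Pair s,
      ε + 4 * R * δ < ‖W.1 q.1.2 - W.1 q.1.1‖ → W ∉ hits d ε δ q.1.1 q.1.2 := by
    intro W hW q hq hc
    have := norm_le_of_mem_hits hε hR hW hc
    nlinarith
  have hEs : dotForm d s (scatter ε δ p.1.1 p.1.2 Z).2 (scatter ε δ p.1.1 p.1.2 Z).2 ≤ R ^ 2 := by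
    rw [hsc]; exact hE'
  refine ⟨⟨h0, hδ⟩, ?_, ?_, ?_, ?_, hin, ?_, hEs, ?_⟩
  · refine fun q => ⟨fun hq => ?_, fun hq => by cases hq; exact hp⟩
    by_contra hne
    have hqp : q ≠ p := fun h => hne (by rw [h])
    exact hnothit hE q (by nlinarith [hfar q hqp]) hq
  · refine fun q => ⟨fun hq => ?_, fun hq => by
      cases hq; exact (reverse_scatter_involutive hε hij hp).1⟩
    by_contra hne
    have hqp : q ≠ p := fun h => hne (by rw [h])
    refine hnothit ?_ q ?_ hq
    · simpa [reverse] using hEs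
    · rw [hsc]; exact hfree' (δ - τ) (by linarith) le_rfl q hqp
  · intro u hu0 hu
    rw [mem_phaseSpace_iff]
    intro q
    by_cases hq : q = p
    · subst hq
      rw [freeFlow_rel]
      exact WillHit.lt_norm_before hε hp (hτ ▸ hu)
    · exact hfree u hu0 hu.le q hq
  · exact mem_contact hnorm (hfree τ h0.le le_rfl)
  · intro u hu0 hu
    rw [mem_phaseSpace_iff]
    intro q
    by_cases hq : q = p
    · subst hq
      rw [freeFlow_rel]
      refine lt_norm_after (y := Y'.1 q.1.2 - Y'.1 q.1.1) hnorm ?_ hu0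
      rw [hY', rel_collide_inner hε hij hnorm']
      linarith
    · nlinarith [hfree' u hu0.le hu q hq]
  · rw [hsc]
    exact hmove (δ - τ) (by linarith) le_rfl

end Step

/-! ### Arithmetic of the admissible values. -/

section Values

/-- The values which `φ̂_{N,j}^{(s)}` may take. -/
def Admissible (N j s : ℕ) (x : ℝ) : Prop :=
  (s < j ∧ x = 0) ∨ (s = j ∧ x = 1) ∨
    (j < s ∧ ∃ m : ℕ, x = (∏ k ∈ Finset.Ico j s, ((N : ℝ) - (k : ℝ))) * m)

/-- Below level `j` the four added terms vanish; at `n = j` they are all `1` and contribute `4`;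
above it the factor `N - n` extends the product from `n` to `n + 1`. -/
lemma Admissible.collision {N j n : ℕ} {x a b c e : ℝ} (hx : Admissible N j (n + 1) x)
    (ha : Admissible N j n a) (hb : Admissible N j n b) (hc : Admissible N j n c)
    (he : Admissible N j n e) :
    Admissible N j (n + 1) (x + ((N : ℝ) - n) * (a + b + c + e)) := by
  rcases lt_trichotomy n j with h | h | h
  · have h0 : ∀ {y}, Admissible N j n y → y = 0 := by
      rintro y (h1 | h1 | h1)
      · exact h1.2
      · omega
      · omega
    rw [h0 ha, h0 hb, h0 hc, h0 he]
    simpa using hx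
  · subst h
    have h0 : ∀ {y}, Admissible N n n y → y = 1 := by
      rintro y (h1 | h1 | h1)
      · omega
      · exact h1.2
      · omega
    rw [h0 ha, h0 hb, h0 hc, h0 he]
    rcases hx with hx | hx | ⟨-, m, hx⟩
    · omega
    · omega
    · refine Or.inr (Or.inr ⟨by omega, m + 4, ?_⟩)
      rw [hx]
      simp
      ring
  · have h0 : ∀ {y}, Admissible N j n y →
        ∃ m : ℕ, y = (∏ k ∈ Finset.Ico j n, ((N : ℝ) - (k : ℝ))) * m := by
      rintro y (h1 | h1 | h1)
      · omega
      · omega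
      · exact h1.2
    obtain ⟨m₁, rfl⟩ := h0 ha
    obtain ⟨m₂, rfl⟩ := h0 hb
    obtain ⟨m₃, rfl⟩ := h0 hc
    obtain ⟨m₄, rfl⟩ := h0 he
    rcases hx with hx | hx | ⟨-, m, hx⟩
    · omega
    · omega
    · refine Or.inr (Or.inr ⟨by omega, m + (m₁ + m₂ + m₃ + m₄), ?_⟩)
      rw [hx, Finset.prod_Ico_succ_top h.le]
      push_cast
      ring

end Values

/-! ### Induction on the number of particles, with time discretization. -/

section Induction

variable {d N j n : ℕ} {ε R δ : ℝ} {φ : (s : ℕ) → ℝ → Config d s → ℝ}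

/-- The points at which the solution takes another value. -/
def badSet (N j : ℕ) (ε : ℝ) (φ : (s : ℕ) → ℝ → Config d s → ℝ) (s : ℕ) (t : ℝ) :
    Set (Config d s) :=
  {Z | Z ∈ phaseSpace d ε s ∧ ¬ Admissible N j s (φ s t Z)}

/-- Bounded energy and positions. -/
def boundedSet (d s : ℕ) (R K : ℝ) : Set (Config d s) :=
  {Z | dotForm d s Z.2 Z.2 ≤ R ^ 2 ∧ ∀ k, ‖Z.1 k‖ ≤ K}

lemma twoClosePairs_mono {s : ℕ} {K K' η : ℝ} (h : K ≤ K') :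
    twoClosePairs d s ε K R η ⊆ twoClosePairs d s ε K' R η :=
  fun _ hZ => ⟨fun m => (hZ.1 m).trans h, hZ.2⟩

/-- The configurations from which the removal of a particle leads to a bad point. -/
def badErase (N j : ℕ) (ε : ℝ) (φ : (s : ℕ) → ℝ → Config d s → ℝ) (n : ℕ) (t : ℝ) :
    Set (Config d (n + 1)) :=
  {Z | 1 ≤ n ∧ ∃ k, erase k Z ∈ badSet N j ε φ n t}

lemma volume_badErase (hprev : 1 ≤ n → ∀ t, 0 ≤ t → volume (badSet N j ε φ n t) = 0) {t : ℝ}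
    (ht : 0 ≤ t) : volume (badErase N j ε φ n t) = 0 := by
  by_cases hn : 1 ≤ n
  · have : badErase N j ε φ n t ⊆ ⋃ k, erase k ⁻¹' badSet N j ε φ n t :=
      fun Z hZ => Set.mem_iUnion.2 hZ.2
    exact measure_mono_null this
      (measure_iUnion_null fun k => volume_preimage_erase k (hprev hn t ht))
  · have : badErase N j ε φ n t = ∅ := by ext; simp [badErase, hn]
    rw [this, measure_empty]

/-- By contraposition: off the exceptional sets, one branch of the step map describes the
trajectory, and the value at `Z` is built from values at points that are not bad. Energy is
conserved, while the position bound loosens by `δ * R`. -/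
lemma IsSolution.step_subset (h : IsSolution d N ε φ) (hε : 0 < ε) (hR : 0 ≤ R) (hδ : 0 < δ)
    (hnN : n + 1 ≤ N) {t K : ℝ} (ht : 0 ≤ t) :
    badSet N j ε φ (n + 1) (t + δ) ∩ boundedSet d (n + 1) R K ⊆
      twoClosePairs d (n + 1) ε K R (6 * R * δ) ∪
      ((⋃ p : Pair (n + 1), grazing d ε δ p.1.1 p.1.2) ∪ badErase N j ε φ n (t + δ)) ∪
      {Z | ∃ o, Z ∈ stepDomain d ε δ o ∧ reverse (stepMap ε δ o Z) ∈ stepDomain d ε δ o ∧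
        stepMap ε δ o Z ∈ (badSet N j ε φ (n + 1) t ∩ boundedSet d (n + 1) R (K + δ * R)) ∪
          badErase N j ε φ n t} := by
  rintro Z ⟨⟨hZ, hbad⟩, hE, hK⟩
  by_contra hcon
  simp only [Set.mem_union, not_or, Set.mem_iUnion, not_exists] at hcon
  obtain ⟨⟨hclose, hg, her⟩, hstep⟩ := hcon
  rw [Set.mem_ofPred_eq, not_exists] at hstep
  have hZp := mem_phaseSpace_iff.1 hZ
  by_cases hh : ∀ p : Pair (n + 1), Z ∉ hits d ε δ p.1.1 p.1.2
  · obtain ⟨h1, h2⟩ := step_none hε hZ hg hh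
    have e : φ (n + 1) (t + δ) Z = φ (n + 1) t (freeFlow δ Z) :=
      h.transport (n + 1) (by omega) hnN Z t δ ht hδ (Or.inl hZ)
        (Or.inl (h1 δ hδ.le le_rfl)) fun u hu => h1 u hu.1.le hu.2.le
    refine hstep none ⟨fun p => by simp [hh p], h2, Or.inl ⟨⟨h1 δ hδ.le le_rfl, ?_⟩, hE, ?_⟩⟩
    · exact e ▸ hbad
    · intro k
      have g1 := freeFlow_sub_le hR hE hδ.le k
      have g2 := norm_le_norm_add_norm_sub' ((freeFlow δ Z).1 k) (Z.1 k)
      simp only [stepMap]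
      linarith [hK k]
  · push Not at hh
    obtain ⟨p, hp⟩ := hh
    have hRδ : 0 ≤ R * δ := mul_nonneg hR hδ.le
    have hfar : ∀ q : Pair (n + 1), q ≠ p → ε + 6 * R * δ < ‖Z.1 q.1.2 - Z.1 q.1.1‖ := by
      intro q hq
      by_contra! hc
      refine hclose ⟨hK, norm_le_of_energy hR hE, q, p, hq, ⟨hZp q, hc⟩, hZp p, ?_⟩
      have := norm_le_of_mem_hits hε hR hE hp
      linarith
    obtain ⟨⟨h0, hτδ⟩, h1, h2, h3, h4, h5, h6, h7, h8⟩ := step_some hε hR hE hp hfar rfl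
    set τ := hitTime ε (Z.1 p.1.2 - Z.1 p.1.1) (Z.2 p.1.2 - Z.2 p.1.1) with hτ
    have hsc : scatter ε δ p.1.1 p.1.2 Z =
      freeFlow (δ - τ) (collide ε p.1.1 p.1.2 (freeFlow τ Z)) := by rw [scatter, ← hτ]
    have hn : 1 ≤ n := by
      have a := p.2
      have b := p.1.1.isLt
      have c := p.1.2.isLt
      rw [Fin.lt_def] at a
      omega
    have hin : scatter ε δ p.1.1 p.1.2 Z ∈ phaseSpace d ε (n + 1) := by
      rw [hsc]; exact h6 _ (by linarith) le_rfl
    have e := h.through_collision hε hn hnN p.2.ne ht h0 (sub_pos.2 hτδ) h3 h4 h5 h6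
    rw [← hsc, sub_add_cancel] at e
    have hstep' := fun hc => hstep (some p) ⟨h1, h2, hc⟩
    simp only [stepMap] at hstep'
    have good : ∀ i, Admissible N j n (φ n (t + δ) (erase i Z)) := by
      intro i
      by_contra hc
      exact her ⟨hn, i, erase_mem_phaseSpace hZ i, hc⟩
    have good' : ∀ i, Admissible N j n (φ n t (erase i (scatter ε δ p.1.1 p.1.2 Z))) := by
      intro i
      by_contra hc
      exact hstep' (Or.inr ⟨hn, i, erase_mem_phaseSpace hin i, hc⟩)
    have good'' : Admissible N j (n + 1) (φ (n + 1) t (scatter ε δ p.1.1 p.1.2 Z)) := by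
      by_contra hc
      refine hstep' (Or.inl ⟨⟨hin, hc⟩, h7, fun k => ?_⟩)
      have g1 := h8 k
      have g2 := norm_le_norm_add_norm_sub' ((scatter ε δ p.1.1 p.1.2 Z).1 k) (Z.1 k)
      linarith [hK k]
    exact hbad (e ▸ good''.collision (good _) (good _) (good' _) (good' _))

lemma IsSolution.volume_step_le (h : IsSolution d N ε φ) (hε : 0 < ε) (hR : 0 ≤ R) (hδ : 0 < δ)
    (hnN : n + 1 ≤ N) (hprev : 1 ≤ n → ∀ t, 0 ≤ t → volume (badSet N j ε φ n t) = 0)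
    {t K : ℝ} (ht : 0 ≤ t) :
    volume (badSet N j ε φ (n + 1) (t + δ) ∩ boundedSet d (n + 1) R K) ≤
      volume (badSet N j ε φ (n + 1) t ∩ boundedSet d (n + 1) R (K + δ * R)) +
        volume (twoClosePairs d (n + 1) ε K R (6 * R * δ)) := by
  set A := badSet N j ε φ (n + 1) t ∩ boundedSet d (n + 1) R (K + δ * R)
  set B := badErase N j ε φ n t
  have hnull : volume ((⋃ p : Pair (n + 1), grazing d ε δ p.1.1 p.1.2) ∪
      badErase N j ε φ n (t + δ)) = 0 :=
    measure_union_null (measure_iUnion_null fun p => volume_grazing hε hδ p.2.ne)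
      (volume_badErase hprev (by linarith))
  have hU : volume {Z : Config d (n + 1) | ∃ o, Z ∈ stepDomain d ε δ o ∧
      reverse (stepMap ε δ o Z) ∈ stepDomain d ε δ o ∧ stepMap ε δ o Z ∈ A ∪ B} ≤ volume A := by
    -- The solution is not assumed measurable, so the target is first enlarged to a measurable hull
    -- of the same volume.
    calc _ ≤ volume {Z : Config d (n + 1) | ∃ o, Z ∈ stepDomain d ε δ o ∧
          reverse (stepMap ε δ o Z) ∈ stepDomain d ε δ o ∧
          stepMap ε δ o Z ∈ toMeasurable volume (A ∪ B)} :=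
          by
            refine measure_mono ?_
            rintro Z ⟨o, h1, h2, h3⟩
            exact ⟨o, h1, h2, subset_toMeasurable _ _ h3⟩
      _ ≤ volume (toMeasurable volume (A ∪ B)) :=
          measure_stepMap_preimage_le hε (measurableSet_toMeasurable _ _)
      _ = volume (A ∪ B) := measure_toMeasurable _
      _ ≤ volume A + volume B := measure_union_le _ _
      _ = volume A := by rw [volume_badErase hprev ht, add_zero]
  calc _ ≤ _ := measure_mono (h.step_subset hε hR hδ hnN ht)
    _ ≤ _ := measure_union_le _ _
    _ ≤ (volume (twoClosePairs d (n + 1) ε K R (6 * R * δ)) + 0) + volume A := by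
        gcongr
        exact (measure_union_le _ _).trans (by rw [hnull])
    _ = _ := by rw [add_zero, add_comm]

/-- The position radius grows as the iteration goes back in time; all the error sets are placed in
the one with the largest radius, which depends only on the total time. -/
lemma IsSolution.volume_iterate_le (h : IsSolution d N ε φ) (hε : 0 < ε) (hR : 0 ≤ R) (hδ : 0 < δ)
    (hnN : n + 1 ≤ N) (hprev : 1 ≤ n → ∀ t, 0 ≤ t → volume (badSet N j ε φ n t) = 0)
    (hinit : badSet N j ε φ (n + 1) 0 = ∅) (m : ℕ) (K : ℝ) :
    volume (badSet N j ε φ (n + 1) (m * δ) ∩ boundedSet d (n + 1) R K) ≤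
      m * volume (twoClosePairs d (n + 1) ε (K + m * δ * R) R (6 * R * δ)) := by
  induction m generalizing K with
  | zero => simp [hinit]
  | succ m ih =>
    have h1 := h.volume_step_le hε hR hδ hnN hprev (t := m * δ) (K := K) (by positivity)
    have e : ((m + 1 : ℕ) : ℝ) * δ = m * δ + δ := by push_cast; ring
    have hRδ : 0 ≤ δ * R := by positivity
    have hm : (0 : ℝ) ≤ m * δ * R := by positivity
    rw [e]
    refine h1.trans ?_
    rw [Nat.cast_add, Nat.cast_one, add_mul, one_mul]
    refine add_le_add ((ih _).trans ?_) (measure_mono (twoClosePairs_mono (by nlinarith)))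
    gcongr
    exact twoClosePairs_mono (by nlinarith)

/-- With `m` steps of length `t / m` the total error is at most `m * C * (b / m) ^ 2 = C * b ^ 2 /
m`. Countably many bounded sets then exhaust the phase space. -/
lemma IsSolution.volume_badSet_succ (h : IsSolution d N ε φ) (hε : 0 < ε)
    (hnN : n + 1 ≤ N) (hprev : 1 ≤ n → ∀ t, 0 ≤ t → volume (badSet N j ε φ n t) = 0)
    (hinit : badSet N j ε φ (n + 1) 0 = ∅) {t : ℝ} (ht : 0 ≤ t) :
    volume (badSet N j ε φ (n + 1) t) = 0 := by
  rcases ht.eq_or_lt with rfl | ht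
  · rw [hinit, measure_empty]
  have key : ∀ a : ℕ × ℕ,
      volume (badSet N j ε φ (n + 1) t ∩ boundedSet d (n + 1) a.1 a.2) = 0 := by
    rintro ⟨r, K⟩
    obtain ⟨C, hC, hCle⟩ := exists_volume_twoClosePairs_le d (n + 1) hε (K + t * r) r
    set b : ℝ := 6 * r * t with hb
    have hb0 : 0 ≤ b := by positivity
    have hlim : Tendsto (fun m : ℕ => C * ENNReal.ofReal (b ^ 2 / m)) atTop (𝓝 0) := by
      have h1 := ENNReal.tendsto_ofReal (tendsto_const_div_atTop_nhds_zero_nat (b ^ 2))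
      have h2 := ENNReal.Tendsto.const_mul h1 (Or.inr hC)
      simpa using h2
    refine le_antisymm (ge_of_tendsto hlim ?_) zero_le
    filter_upwards [eventually_gt_atTop 0,
      (tendsto_const_div_atTop_nhds_zero_nat b).eventually (gt_mem_nhds zero_lt_one)] with m hm hbm
    have hm' : (0 : ℝ) < m := by exact_mod_cast hm
    have h1 := h.volume_iterate_le hε (Nat.cast_nonneg r) (div_pos ht hm') hnN hprev hinit m K
    have e1 : (m : ℝ) * (t / m) = t := by field_simp
    have e2 : 6 * (r : ℝ) * (t / m) = b / m := by rw [hb]; ring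
    rw [e1, e2] at h1
    refine h1.trans ?_
    calc _ ≤ (m : ENNReal) * (C * ENNReal.ofReal (b / m) ^ 2) := by
          gcongr
          exact hCle _ (by positivity) hbm.le
      _ = C * (ENNReal.ofReal m * ENNReal.ofReal ((b / m) ^ 2)) := by
          rw [ENNReal.ofReal_natCast, ENNReal.ofReal_pow (by positivity)]; ring
      _ = C * ENNReal.ofReal (b ^ 2 / m) := by
          rw [← ENNReal.ofReal_mul hm'.le]
          congr 2
          field_simp
  have hcover : badSet N j ε φ (n + 1) t ⊆
      ⋃ a : ℕ × ℕ, badSet N j ε φ (n + 1) t ∩ boundedSet d (n + 1) a.1 a.2 := by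
    intro Z hZ
    -- The extra `1` ensures `r ≥ 1`, so that `r ≤ r ^ 2` bounds the energy.
    obtain ⟨r, hr⟩ := exists_nat_ge (dotForm d (n + 1) Z.2 Z.2 + 1)
    obtain ⟨K, hK⟩ := exists_nat_ge ‖Z.1‖
    refine Set.mem_iUnion.2 ⟨(r, K), hZ, ?_, fun k => (norm_le_pi_norm Z.1 k).trans hK⟩
    have := dotForm_self_nonneg Z.2
    nlinarith
  exact measure_mono_null hcover (measure_iUnion_null key)

lemma IsPhiHat.volume_badSet (h : IsPhiHat d N ε j φ) (hε : 0 < ε) :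
    ∀ s : ℕ, 1 ≤ s → s ≤ N → ∀ t, 0 ≤ t → volume (badSet N j ε φ s t) = 0 := by
  have hinit : ∀ s : ℕ, 1 ≤ s → s ≤ N → badSet N j ε φ s 0 = ∅ := by
    intro s hs hsN
    refine Set.eq_empty_of_forall_notMem fun Z hZ => hZ.2 ?_
    rw [h.initial s hs hsN Z hZ.1, initialData]
    rcases lt_trichotomy s j with hsj | hsj | hsj
    · exact Or.inl ⟨hsj, by rw [if_neg hsj.ne]⟩
    · exact Or.inr (Or.inl ⟨hsj, by rw [if_pos hsj, Set.indicator_of_mem hZ.1, Pi.one_apply]⟩)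
    · exact Or.inr (Or.inr ⟨hsj, 0, by rw [if_neg hsj.ne']; simp⟩)
  intro s
  induction s with
  | zero => omega
  | succ n ih =>
    intro hs hsN t ht
    exact h.toIsSolution.volume_badSet_succ hε hsN (fun hn => ih hn (by omega)) (hinit _ hs hsN) ht

lemma IsPhiHat.ae_admissible (h : IsPhiHat d N ε j φ) (hε : 0 < ε) {s : ℕ} (hs : 1 ≤ s)
    (hsN : s ≤ N) {t : ℝ} (ht : 0 ≤ t) :
    ∀ᵐ Z : Config d s, Z ∈ phaseSpace d ε s → Admissible N j s (φ s t Z) := by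
  rw [ae_iff]
  simp only [Classical.not_imp]
  exact h.volume_badSet hε s hs hsN t ht

end Induction

end HardSphere

theorem mainTheorem7 (d N : ℕ) (hd : 2 ≤ d) (ε : ℝ) (hε : 0 < ε)
    (j : ℕ) (hj : 1 ≤ j) (hjN : j ≤ N)
    (φ : (s : ℕ) → ℝ → HardSphere.Config d s → ℝ)
    (hφ : HardSphere.IsPhiHat d N ε j φ) :
    (∀ s : ℕ, 1 ≤ s → s < j → ∀ t : ℝ, 0 < t →
      ∀ᵐ Z : HardSphere.Config d s, Z ∈ HardSphere.phaseSpace d ε s → φ s t Z = 0) ∧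
    (∀ t : ℝ, 0 < t →
      ∀ᵐ Z : HardSphere.Config d j, Z ∈ HardSphere.phaseSpace d ε j →
        φ j t Z = (HardSphere.phaseSpace d ε j).indicator 1 Z) ∧
    (∀ s : ℕ, j < s → s ≤ N → ∀ t : ℝ, 0 < t →
      ∀ᵐ Z : HardSphere.Config d s, Z ∈ HardSphere.phaseSpace d ε s →
        0 ≤ φ s t Z ∧ ∃ m : ℤ, φ s t Z = (∏ k ∈ Finset.Ico j s, ((N : ℝ) - (k : ℝ))) * (m : ℝ)) := by
  refine ⟨fun s hs hsj t ht => ?_, fun t ht => ?_, fun s hsj hsN t ht => ?_⟩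
  · filter_upwards [hφ.ae_admissible hε hs (by omega) ht.le] with Z h hZ
    rcases h hZ with h | h | h
    · exact h.2
    · omega
    · omega
  · filter_upwards [hφ.ae_admissible hε hj hjN ht.le] with Z h hZ
    rw [Set.indicator_of_mem hZ]
    rcases h hZ with h | h | h
    · omega
    · exact h.2
    · omega
  · filter_upwards [hφ.ae_admissible hε (by omega) hsN ht.le] with Z h hZ
    rcases h hZ with h | h | ⟨-, m, h⟩
    · omega
    · omega
    · refine ⟨?_, m, by simpa using h⟩
      rw [h]
      refine mul_nonneg (Finset.prod_nonneg fun k hk => ?_) (Nat.cast_nonneg m)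
      have : k ≤ N := by
        have := (Finset.mem_Ico.1 hk).2
        omega
      exact sub_nonneg.2 (by exact_mod_cast this)
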